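/- Let $N\ge 1$ and $1<p<\infty$. For an open set $\Omega\subset\mathbb{R}^N$ put $$\lambda_p(\Omega)=\inf_{u\in C^\infty_0(\Omega)\setminus\{0\}}\frac{\int_\Omega|\nabla u|^p\,dx}{\int_\Omega|u|^p\,dx},\qquad \pi_p=\inf\left\{\frac{\|\varphi'\|_{L^p([0,1])}}{\|\varphi\|_{L^p([0,1])}}\,:\,\varphi\in C^1([0,1])\setminus\{0\},\ \varphi(0)=\varphi(1)=0\right\},$$ let $|\Omega|$ be the $N$-dimensional Lebesgue measure of $\Omega$, and let $$P(\Omega)=\sup\left\{\int_\Omega \mathrm{div}\,X\,dx\,:\,X\in C^1_c(\mathbb{R}^N;\mathbb{R}^N),\ |X|\le 1\right\}$$ be its distributional perimeter. Then for every non-empty open bounded convex set $\Omega\subset\mathbb{R}^N$ $$\lambda_p(\Omega)\ge\left(\frac{\pi_p}{2N}\right)^p\left(\frac{P(\Omega)}{|\Omega|}\right)^p .$$ The inequality is sharp: the constant $(\pi_p/(2N))^p$ cannot be replaced by a larger one. Equality is attained asymptotically by the collapsing pyramids: for $\alpha>0$ let $C_\alpha$ be the interior of the convex hull of $\big((-1,1)^{N-1}\times\{0\}\big)\cup\{(0,\dots,0,\alpha)\}$,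 which is a non-empty open bounded convex set; then $$\lim_{\alpha\to0^+}\lambda_p(C_\alpha)\left(\frac{P(C_\alpha)}{|C_\alpha|}\right)^{-p}=\left(\frac{\pi_p}{2N}\right)^p .$$ -/

import Mathlib

open Set Filter Topology MeasureTheory
open scoped ENNReal ContDiff

noncomputable section

/-- The first Dirichlet eigenvalue of the `p`-Laplacian on an open set `Ω ⊆ ℝ^N`: the infimum of
`∫_Ω |∇u|^p / ∫_Ω |u|^p` over the nonzero `u ∈ C_c^∞(Ω)`. Both integrals are finite and the
denominator is positive for every such `u`. -/
def firstEigenvalue {N : ℕ} (p : ℝ) (Ω : Set (EuclideanSpace ℝ (Fin N))) : ℝ≥0∞ :=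
  ⨅ (u : EuclideanSpace ℝ (Fin N) → ℝ)
    (_ : ContDiff ℝ ∞ u ∧ HasCompactSupport u ∧ tsupport u ⊆ Ω ∧ u ≠ 0),
    (∫⁻ x in Ω, ‖gradient u x‖ₑ ^ p) / (∫⁻ x in Ω, ‖u x‖ₑ ^ p)

/-- The one-dimensional Poincaré constant `π_p`: the infimum of
`‖φ'‖_{L^p([0,1])} / ‖φ‖_{L^p([0,1])}` over the `φ ∈ C^1([0,1])`, not identically zero on `[0,1]`,
with `φ(0) = φ(1) = 0`. -/
def poincarePi (p : ℝ) : ℝ≥0∞ :=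
  ⨅ (φ : ℝ → ℝ)
    (_ : ContDiffOn ℝ 1 φ (Icc 0 1) ∧ φ 0 = 0 ∧ φ 1 = 0 ∧ ∃ t ∈ Icc (0 : ℝ) 1, φ t ≠ 0),
    eLpNorm (derivWithin φ (Icc 0 1)) (ENNReal.ofReal p) (volume.restrict (Icc 0 1)) /
      eLpNorm φ (ENNReal.ofReal p) (volume.restrict (Icc 0 1))

/-- The divergence of a vector field on `ℝ^N`. -/
def divergence {N : ℕ} (X : EuclideanSpace ℝ (Fin N) → EuclideanSpace ℝ (Fin N))
    (x : EuclideanSpace ℝ (Fin N)) : ℝ :=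
  ∑ i : Fin N, (fderiv ℝ X x (EuclideanSpace.single i 1)) i

/-- The distributional (De Giorgi) perimeter of `E ⊆ ℝ^N`: the supremum of `∫_E div X` over the
compactly supported `C^1` vector fields `X` on `ℝ^N` with `|X| ≤ 1`. -/
def perimeter {N : ℕ} (E : Set (EuclideanSpace ℝ (Fin N))) : ℝ≥0∞ :=
  ⨆ (X : EuclideanSpace ℝ (Fin N) → EuclideanSpace ℝ (Fin N))
    (_ : ContDiff ℝ 1 X ∧ HasCompactSupport X ∧ ∀ x, ‖X x‖ ≤ 1),
    ENNReal.ofReal (∫ x in E, divergence X x)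

/-- The collapsing pyramid `C_α ⊆ ℝ^N` of height `α`, as an open set: the interior of the convex
hull of the flat base `(-1,1)^{N-1} × {0}` and the apex `(0,…,0,α)`. The last coordinate is the one
whose index `i` satisfies `i + 1 = N`. -/
def collapsingPyramid (N : ℕ) (α : ℝ) : Set (EuclideanSpace ℝ (Fin N)) :=
  interior (convexHull ℝ
    ({x : EuclideanSpace ℝ (Fin N) |
        (∀ i : Fin N, (i : ℕ) + 1 < N → x i ∈ Ioo (-1 : ℝ) 1) ∧
        (∀ i : Fin N, (i : ℕ) + 1 = N → x i = 0)} ∪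
      {WithLp.toLp 2 (fun i : Fin N => if (i : ℕ) + 1 = N then α else 0)}))

end

/-! The lower bound combines two inequalities for convex `Ω`. First, if `Ω` contains a ball of
radius `r`, then `r P(Ω) ≤ N |Ω|`: for a field `X` with `|X| ≤ 1`, the map `x ↦ x + s X(x)` sends
`Ω` into its dilation of ratio `1 + s / r` about the centre of the ball. Comparing volumes and
differentiating at `s = 0` bounds `∫_Ω div X` (`perimeter_mul_le`). So every inscribed radius is at
most `R = N |Ω| / P(Ω)`. Second, Hersch's inequality `λ_p ≥ (π_p / (2R))^p`
(`poincarePi_rpow_mul_lintegral_le_of_inradius`). Enclose `Ω` in a polytope contained in a slightly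
dilated copy of `Ω`, and cut the polytope into cells according to the nearest facet. A cell is a
union of segments orthogonal to its facet, no longer than the inradius, and a test function vanishes
at the facet end. On a segment of length `l`, reflection turns this one-sided condition into a
Dirichlet problem on length `2l`, with constant `π_p / (2l)`
(`poincarePi_rpow_mul_lintegral_Icc_le`). Integrating over segments, summing over cells and letting
the dilation ratio tend to one gives the claim, since `π_p / (2R) = (π_p / (2N)) P(Ω) / |Ω|`. For
sharpness, fields along the axis show that `P / |C_α| ≥ 2N / α` (`le_perimeter_collapsingPyramid`).
A product test function on a box of height comparable to `α` and fixed width gives `λ_p(C_α) ≤ (K +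
c / α)^p` for any finite `c > π_p`, with `K` independent of `α`
(`firstEigenvalue_collapsingPyramid_le`). The quotient is thus at most `((Kα + c) / (2N))^p`, which
tends to `(c / (2N))^p`; the lower bound supplies the rest. -/

/-! ### One-dimensional Poincaré inequalities -/

/-- The `p`-th power integral of a continuous function, as a lower integral. -/
lemma lintegral_enorm_rpow_Icc {f : ℝ → ℝ} (hf : Continuous f) {p : ℝ} (hp : 0 < p) {a b : ℝ}
    (hab : a ≤ b) :
    ∫⁻ x in Icc a b, ‖f x‖ₑ ^ p = ENNReal.ofReal (∫ x in a..b, |f x| ^ p) := by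
  have hc : Continuous fun x => |f x| ^ p := hf.abs.rpow_const fun x => Or.inr hp.le
  rw [intervalIntegral.integral_of_le hab, ← integral_Icc_eq_integral_Ioc,
    ofReal_integral_eq_lintegral_ofReal hc.continuousOn.integrableOn_Icc
      (Eventually.of_forall fun x => by positivity)]
  refine lintegral_congr fun x => ?_
  rw [← ENNReal.ofReal_rpow_of_nonneg (abs_nonneg _) hp.le, ← Real.norm_eq_abs,
    ofReal_norm]

lemma lintegral_rpow_eq_eLpNorm_rpow {α : Type*} [MeasurableSpace α] {μ : Measure α} {f : α → ℝ}
    {p : ℝ} (hp : 0 < p) :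
    eLpNorm f (ENNReal.ofReal p) μ = (∫⁻ x, ‖f x‖ₑ ^ p ∂μ) ^ (1 / p) := by
  rw [eLpNorm_eq_lintegral_rpow_enorm_toReal (by simpa using hp) ENNReal.ofReal_ne_top,
    ENNReal.toReal_ofReal hp.le]

lemma poincarePi_rpow_mul_lintegral_le {p : ℝ} (hp : 1 < p) {φ : ℝ → ℝ} (hφ : ContDiff ℝ 1 φ)
    (h0 : φ 0 = 0) (h1 : φ 1 = 0) :
    poincarePi p ^ p * ∫⁻ x in Icc 0 1, ‖φ x‖ₑ ^ p ≤ ∫⁻ x in Icc 0 1, ‖deriv φ x‖ₑ ^ p := by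
  have hp0 : 0 < p := by linarith
  by_cases hz : ∃ t ∈ Icc (0 : ℝ) 1, φ t ≠ 0
  · have hle : poincarePi p ≤ eLpNorm (derivWithin φ (Icc 0 1)) (ENNReal.ofReal p)
        (volume.restrict (Icc 0 1)) / eLpNorm φ (ENNReal.ofReal p) (volume.restrict (Icc 0 1)) :=
      iInf₂_le φ ⟨hφ.contDiffOn, h0, h1, hz⟩
    have hd : eLpNorm (derivWithin φ (Icc 0 1)) (ENNReal.ofReal p) (volume.restrict (Icc 0 1)) =
        eLpNorm (deriv φ) (ENNReal.ofReal p) (volume.restrict (Icc 0 1)) := by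
      refine eLpNorm_congr_ae ?_
      filter_upwards [ae_restrict_mem measurableSet_Icc] with x hx
      exact ((hφ.differentiable one_ne_zero) x).derivWithin
        (uniqueDiffOn_Icc zero_lt_one x hx)
    rw [hd, lintegral_rpow_eq_eLpNorm_rpow hp0, lintegral_rpow_eq_eLpNorm_rpow hp0,
      ← ENNReal.div_rpow_of_nonneg _ _ (by positivity)] at hle
    have := ENNReal.rpow_le_rpow hle hp0.le
    rw [← ENNReal.rpow_mul, one_div_mul_cancel hp0.ne', ENNReal.rpow_one] at this
    exact ENNReal.mul_le_of_le_div this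
  · push Not at hz
    rw [setLIntegral_congr_fun (g := fun _ => 0) measurableSet_Icc
      fun x hx => by simp [hz x hx, hp0]]
    simp

/-- A smooth concave function on `[0,1]` vanishing at the endpoints, that approximates the tent
`t ↦ 1/2 - |t - 1/2|` as `δ → 0`. -/
noncomputable def smoothTent (δ t : ℝ) : ℝ := √(1 / 4 + δ ^ 2) - √((t - 1 / 2) ^ 2 + δ ^ 2)

lemma smoothTent_zero_left (t : ℝ) : smoothTent 0 t = 1 / 2 - |t - 1 / 2| := by
  simp only [smoothTent, ne_eq, OfNat.ofNat_ne_zero, not_false_eq_true, zero_pow, add_zero,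
    Real.sqrt_sq_eq_abs]
  congr 1
  rw [show (1 / 4 : ℝ) = (1 / 2) ^ 2 by norm_num, Real.sqrt_sq (by norm_num)]

lemma smoothTent_zero_right (δ : ℝ) : smoothTent δ 0 = 0 := by
  simp only [smoothTent]; norm_num

lemma smoothTent_one_right (δ : ℝ) : smoothTent δ 1 = 0 := by
  simp only [smoothTent]; norm_num

lemma continuous_smoothTent : Continuous fun q : ℝ × ℝ => smoothTent q.1 q.2 := by
  unfold smoothTent; fun_prop

lemma contDiff_smoothTent {δ : ℝ} (hδ : 0 < δ) : ContDiff ℝ 1 (smoothTent δ) := by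
  unfold smoothTent
  refine contDiff_const.sub (ContDiff.sqrt (by fun_prop) fun t => by positivity)

lemma abs_deriv_smoothTent_le {δ : ℝ} (hδ : 0 < δ) (t : ℝ) : |deriv (smoothTent δ) t| ≤ 1 := by
  have h1 : HasDerivAt (fun t : ℝ => (t - 1 / 2) ^ 2 + δ ^ 2) (2 * (t - 1 / 2)) t := by
    have := (((hasDerivAt_id t).sub_const (1 / 2)).pow 2).add_const (δ ^ 2)
    simpa using this
  have h2 := (h1.sqrt (by positivity)).const_sub (√(1 / 4 + δ ^ 2))
  have h3 : deriv (smoothTent δ) t = -(2 * (t - 1 / 2) / (2 * √((t - 1 / 2) ^ 2 + δ ^ 2))) :=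
    h2.deriv
  have hpos : 0 < √((t - 1 / 2) ^ 2 + δ ^ 2) := Real.sqrt_pos.2 (by positivity)
  rw [h3, abs_neg, abs_div, abs_mul, abs_mul, abs_of_pos hpos, mul_div_mul_left _ _ (by norm_num),
    div_le_one hpos]
  exact Real.abs_le_sqrt (by nlinarith [sq_nonneg δ])

/-- The scaled tent maps each half of `[0,1]` affinely onto `[0,l]` with slope `±2l`, so each half
contributes `(2l)⁻¹` times the integral. This replaces an even reflection of `g` about `l`. -/
lemma integral_tent_comp {g : ℝ → ℝ} (hg : Continuous g) {l : ℝ} (hl : 0 < l) :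
    ∫ t in (0 : ℝ)..1, g (2 * l * (1 / 2 - |t - 1 / 2|)) = l⁻¹ * ∫ t in (0 : ℝ)..l, g t := by
  have hc : Continuous fun t : ℝ => g (2 * l * (1 / 2 - |t - 1 / 2|)) := by fun_prop
  rw [← intervalIntegral.integral_add_adjacent_intervals
    (hc.intervalIntegrable 0 (1 / 2)) (hc.intervalIntegrable (1 / 2) 1)]
  have e1 : ∫ t in (0 : ℝ)..(1 / 2), g (2 * l * (1 / 2 - |t - 1 / 2|)) =
      ∫ t in (0 : ℝ)..(1 / 2), g ((2 * l) * t) := by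
    refine intervalIntegral.integral_congr fun t ht => ?_
    rw [uIcc_of_le (by norm_num)] at ht
    rw [abs_of_nonpos (by linarith [ht.2])]; ring_nf
  have e2 : ∫ t in (1 / 2 : ℝ)..1, g (2 * l * (1 / 2 - |t - 1 / 2|)) =
      ∫ t in (1 / 2 : ℝ)..1, g (2 * l - (2 * l) * t) := by
    refine intervalIntegral.integral_congr fun t ht => ?_
    rw [uIcc_of_le (by norm_num)] at ht
    rw [abs_of_nonneg (by linarith [ht.1])]; ring_nf
  rw [e1, e2, intervalIntegral.integral_comp_mul_left _ (by positivity),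
    intervalIntegral.integral_comp_sub_mul _ (by positivity)]
  have h1 : 2 * l * 0 = 0 := by ring
  have h2 : 2 * l * (1 / 2) = l := by ring
  have h3 : 2 * l - 2 * l * 1 = 0 := by ring
  have h4 : 2 * l - l = l := by ring
  rw [h1, h2, h3, h4, smul_eq_mul]
  field_simp
  ring

/-- One-dimensional Poincaré inequality with a mixed boundary condition. -/
lemma poincarePi_rpow_mul_lintegral_Icc_le {p : ℝ} (hp : 1 < p) {u : ℝ → ℝ}
    (hu : ContDiff ℝ 1 u) (h0 : u 0 = 0) {l : ℝ} (hl : 0 < l) :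
    poincarePi p ^ p * ∫⁻ x in Icc 0 l, ‖u x‖ₑ ^ p ≤
      ENNReal.ofReal (2 * l) ^ p * ∫⁻ x in Icc 0 l, ‖deriv u x‖ₑ ^ p := by
  have hp0 : 0 < p := by linarith
  have hu' : Continuous (deriv u) := hu.continuous_deriv le_rfl
  have huc : Continuous u := hu.continuous
  have hpow : Continuous fun x : ℝ => |x| ^ p := continuous_abs.rpow_const fun x => Or.inr hp0.le
  -- The reflection of `u` about `l` is only Lipschitz, so it is not a competitor for `π_p`. The
  -- smoothed tent with `δ > 0` gives `C^1` competitors, and `A`, `B` are continuous down to `δ =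
  -- 0`.
  set A : ℝ → ℝ := fun δ => ∫ t in (0 : ℝ)..1, |u (2 * l * smoothTent δ t)| ^ p
  set B : ℝ → ℝ := fun δ => ∫ t in (0 : ℝ)..1, |deriv u (2 * l * smoothTent δ t)| ^ p
  have hA : Continuous A := by
    refine intervalIntegral.continuous_parametric_intervalIntegral_of_continuous
      (f := fun δ t => |u (2 * l * smoothTent δ t)| ^ p) ?_ continuous_const
    exact hpow.comp (huc.comp (continuous_const.mul continuous_smoothTent))
  have hB : Continuous B := by
    refine intervalIntegral.continuous_parametric_intervalIntegral_of_continuous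
      (f := fun δ t => |deriv u (2 * l * smoothTent δ t)| ^ p) ?_ continuous_const
    exact hpow.comp (hu'.comp (continuous_const.mul continuous_smoothTent))
  have hA0 : A 0 = l⁻¹ * ∫ t in (0 : ℝ)..l, |u t| ^ p := by
    simp only [A, smoothTent_zero_left]
    exact integral_tent_comp (g := fun x => |u x| ^ p) (hpow.comp huc) hl
  have hB0 : B 0 = l⁻¹ * ∫ t in (0 : ℝ)..l, |deriv u t| ^ p := by
    simp only [B, smoothTent_zero_left]
    exact integral_tent_comp (g := fun x => |deriv u x| ^ p) (hpow.comp hu') hl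
  have key : ∀ δ > 0, poincarePi p ^ p * ENNReal.ofReal (A δ) ≤
      ENNReal.ofReal ((2 * l) ^ p * B δ) := by
    intro δ hδ
    have hs := contDiff_smoothTent hδ
    have hc : ContDiff ℝ 1 fun t => u (2 * l * smoothTent δ t) :=
      hu.comp (contDiff_const.mul hs)
    have h := poincarePi_rpow_mul_lintegral_le hp hc (by simp [smoothTent_zero_right, h0])
      (by simp [smoothTent_one_right, h0])
    rw [lintegral_enorm_rpow_Icc hc.continuous hp0 zero_le_one,
      lintegral_enorm_rpow_Icc (hc.continuous_deriv le_rfl) hp0 zero_le_one] at h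
    refine h.trans (ENNReal.ofReal_le_ofReal ?_)
    rw [← intervalIntegral.integral_const_mul]
    refine intervalIntegral.integral_mono_on zero_le_one
      ((hpow.comp (hc.continuous_deriv le_rfl)).intervalIntegrable _ _)
      ((continuous_const.mul (hpow.comp (hu'.comp
        (continuous_const.mul hs.continuous)))).intervalIntegrable _ _) fun t _ => ?_
    -- The chain rule gives the factor `2l`; the slope of the smoothed tent is at most one.
    have hder : deriv (fun t => u (2 * l * smoothTent δ t)) t =
        deriv u (2 * l * smoothTent δ t) * (2 * l * deriv (smoothTent δ) t) :=
      HasDerivAt.deriv (((hu.differentiable one_ne_zero) _).hasDerivAt.comp t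
        (((hs.differentiable one_ne_zero) t).hasDerivAt.const_mul (2 * l)))
    rw [hder, ← Real.mul_rpow (by positivity) (abs_nonneg _), abs_mul, abs_mul,
      abs_of_pos (show 0 < 2 * l by positivity)]
    refine Real.rpow_le_rpow (by positivity) ?_ hp0.le
    calc _ = 2 * l * |deriv u (2 * l * smoothTent δ t)| * |deriv (smoothTent δ) t| := by ring
      _ ≤ _ := mul_le_of_le_one_right (by positivity) (abs_deriv_smoothTent_le hδ t)
  have hlim : poincarePi p ^ p * ENNReal.ofReal (A 0) ≤ ENNReal.ofReal ((2 * l) ^ p * B 0) := by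
    -- Finiteness of `π_p` is not available here, and multiplication by `⊤` is discontinuous at
    -- zero, so a vanishing limit is treated apart.
    by_cases hz : ENNReal.ofReal (A 0) = 0
    · simp [hz]
    have t1 : Tendsto (fun δ => poincarePi p ^ p * ENNReal.ofReal (A δ)) (𝓝[>] 0)
        (𝓝 (poincarePi p ^ p * ENNReal.ofReal (A 0))) :=
      ENNReal.Tendsto.const_mul (((ENNReal.continuous_ofReal.comp hA).tendsto 0).mono_left
        nhdsWithin_le_nhds) (Or.inl hz)
    have t2 : Tendsto (fun δ => ENNReal.ofReal ((2 * l) ^ p * B δ)) (𝓝[>] 0)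
        (𝓝 (ENNReal.ofReal ((2 * l) ^ p * B 0))) :=
      ((ENNReal.continuous_ofReal.comp (continuous_const.mul hB)).tendsto 0).mono_left
        nhdsWithin_le_nhds
    exact le_of_tendsto_of_tendsto t1 t2 (by
      filter_upwards [self_mem_nhdsWithin] with δ hδ using key δ hδ)
  rw [hA0, hB0, mul_left_comm, ENNReal.ofReal_mul (by positivity),
    ENNReal.ofReal_mul (by positivity), mul_left_comm] at hlim
  have hli : ENNReal.ofReal l⁻¹ ≠ 0 := by simpa using hl
  rw [ENNReal.mul_le_mul_iff_right hli ENNReal.ofReal_ne_top] at hlim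
  rw [lintegral_enorm_rpow_Icc huc hp0 hl.le, lintegral_enorm_rpow_Icc hu' hp0 hl.le,
    ENNReal.ofReal_rpow_of_nonneg (by positivity) hp0.le, ← ENNReal.ofReal_mul (by positivity)]
  exact hlim

/-- The mixed Poincaré inequality on an initial segment of `(0, ρ]`. -/
lemma poincarePi_rpow_mul_setLIntegral_le {p : ℝ} (hp : 1 < p) {u : ℝ → ℝ}
    (hu : ContDiff ℝ 1 u) (h0 : u 0 = 0) {ρ : ℝ} {S : Set ℝ} (hS : S ⊆ Ioc 0 ρ)
    (hS' : ∀ t ∈ S, Ioc 0 t ⊆ S) :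
    poincarePi p ^ p * ∫⁻ x in S, ‖u x‖ₑ ^ p ≤
      ENNReal.ofReal (2 * ρ) ^ p * ∫⁻ x in S, ‖deriv u x‖ₑ ^ p := by
  rcases S.eq_empty_or_nonempty with rfl | hne
  · simp
  have hb : BddAbove S := ⟨ρ, fun t ht => (hS ht).2⟩
  set l := sSup S
  have hlρ : l ≤ ρ := csSup_le hne fun t ht => (hS ht).2
  have hl : 0 < l := by
    obtain ⟨t, ht⟩ := hne
    exact (hS ht).1.trans_le (le_csSup hb ht)
  have h1 : S ⊆ Icc 0 l := fun t ht => ⟨(hS ht).1.le, le_csSup hb ht⟩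
  have h2 : Ioo 0 l ⊆ S := fun t ht => by
    obtain ⟨s, hs, hts⟩ := exists_lt_of_lt_csSup hne ht.2
    exact hS' s hs ⟨ht.1, hts.le⟩
  -- An initial segment differs from `[0, sSup S]` at most by its endpoints.
  have hae : (S : Set ℝ) =ᵐ[volume] Icc 0 l := by
    refine h1.eventuallyLE.antisymm ?_
    exact Ioo_ae_eq_Icc.symm.le.trans h2.eventuallyLE
  rw [setLIntegral_congr hae, setLIntegral_congr hae]
  refine (poincarePi_rpow_mul_lintegral_Icc_le hp hu h0 hl).trans ?_
  gcongr

/-! ### Perimeter, volume and inscribed balls -/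

/-- The Jacobian matrix of a vector field. -/
noncomputable def jacobianMatrix {N : ℕ} (X : EuclideanSpace ℝ (Fin N) → EuclideanSpace ℝ (Fin N))
    (x : EuclideanSpace ℝ (Fin N)) : Matrix (Fin N) (Fin N) ℝ :=
  Matrix.of fun i j => (fderiv ℝ X x (EuclideanSpace.single j 1)) i

lemma det_one_add_smul_fderiv {N : ℕ} (X : EuclideanSpace ℝ (Fin N) → EuclideanSpace ℝ (Fin N))
    (x : EuclideanSpace ℝ (Fin N)) (s : ℝ) :
    (ContinuousLinearMap.id ℝ (EuclideanSpace ℝ (Fin N)) + s • fderiv ℝ X x).det =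
      (1 + s • jacobianMatrix X x).det := by
  rw [ContinuousLinearMap.det,
    ← LinearMap.det_toMatrix (EuclideanSpace.basisFun (Fin N) ℝ).toBasis]
  congr 1
  ext i j
  simp [LinearMap.toMatrix_apply, jacobianMatrix, Matrix.one_apply]

lemma contDiff_det_one_add {ι : Type*} [Fintype ι] [DecidableEq ι] :
    ContDiff ℝ 1 fun A : ι → ι → ℝ => (1 + Matrix.of A).det := by
  simp only [Matrix.det_apply', Matrix.add_apply, Matrix.of_apply]
  fun_prop

/-- A uniform Lipschitz bound for `s ↦ det (1 + s A)` at `s = 0`. -/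
lemma exists_abs_det_one_add_smul_sub_one_le {ι : Type*} [Fintype ι] [DecidableEq ι] {L : ℝ}
    (hL : 0 ≤ L) : ∃ K : ℝ, ∀ A : Matrix ι ι ℝ, (∀ i j, |A i j| ≤ L) → ∀ s ∈ Icc (0 : ℝ) 1,
      |(1 + s • A).det - 1| ≤ K * s := by
  obtain ⟨K, hK⟩ := (contDiff_det_one_add (ι := ι)).contDiffOn.exists_lipschitzOnWith one_ne_zero
    (convex_closedBall (0 : ι → ι → ℝ) L) (isCompact_closedBall _ _)
  -- The determinant is Lipschitz with constant `K` on the ball of matrices with entries bounded by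
  -- `L`, and `s A` stays in it as `s ≤ 1`.
  refine ⟨K * L, fun A hA s hs => ?_⟩
  have hn : ‖(fun i j => s * A i j : ι → ι → ℝ)‖ ≤ s * L := by
    refine (pi_norm_le_iff_of_nonneg (mul_nonneg hs.1 hL)).2 fun i =>
      (pi_norm_le_iff_of_nonneg (mul_nonneg hs.1 hL)).2 fun j => ?_
    rw [Real.norm_eq_abs, abs_mul, abs_of_nonneg hs.1]
    exact mul_le_mul_of_nonneg_left (hA i j) hs.1
  have h := hK.dist_le_mul (fun i j => s * A i j)
    (by rw [mem_closedBall_zero_iff]; nlinarith [hs.2]) 0 (by simpa using hL)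
  have h0 : (1 + Matrix.of (0 : ι → ι → ℝ)).det = 1 := by
    rw [show Matrix.of (0 : ι → ι → ℝ) = 0 from rfl, add_zero, Matrix.det_one]
  rw [h0, dist_zero_right, Real.dist_eq] at h
  refine (le_of_eq ?_).trans (h.trans ?_)
  · rfl
  · rw [mul_assoc, mul_comm L]
    gcongr

/-- The determinant of `1 + s A` is a polynomial in `s` with linear coefficient the trace; `P`
collects the terms of order at least two, divided by `s ^ 2`. -/
lemma tendsto_det_one_add_smul_sub_one_div {ι : Type*} [Fintype ι] [DecidableEq ι]
    (A : Matrix ι ι ℝ) :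
    Tendsto (fun s : ℝ => ((1 + s • A).det - 1) / s) (𝓝[>] 0) (𝓝 A.trace) := by
  set P := (Matrix.det (1 + (Polynomial.X : Polynomial ℝ) • A.map Polynomial.C)).divX.divX
  have h : Tendsto (fun s : ℝ => A.trace + P.eval s * s) (𝓝[>] 0)
      (𝓝 (A.trace + P.eval 0 * 0)) := by
    refine Tendsto.mono_left ?_ nhdsWithin_le_nhds
    have : Continuous fun s : ℝ => A.trace + P.eval s * s := by fun_prop
    exact this.tendsto 0
  rw [mul_zero, add_zero] at h
  refine h.congr' ?_
  filter_upwards [self_mem_nhdsWithin] with s hs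
  have hs' : s ≠ 0 := ne_of_gt hs
  rw [Matrix.det_one_add_smul]
  field_simp
  ring

lemma continuous_jacobianMatrix_apply {N : ℕ}
    {X : EuclideanSpace ℝ (Fin N) → EuclideanSpace ℝ (Fin N)} (hX : ContDiff ℝ 1 X) (i j : Fin N) :
    Continuous fun x => jacobianMatrix X x i j := by
  have := (hX.continuous_fderiv one_ne_zero).clm_apply
    (continuous_const (y := EuclideanSpace.single j (1 : ℝ)))
  exact (EuclideanSpace.proj (𝕜 := ℝ) i).continuous.comp this

lemma continuous_det_one_add_smul_jacobianMatrix {N : ℕ}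
    {X : EuclideanSpace ℝ (Fin N) → EuclideanSpace ℝ (Fin N)} (hX : ContDiff ℝ 1 X) (s : ℝ) :
    Continuous fun x => (1 + s • jacobianMatrix X x).det := by
  refine Continuous.matrix_det ?_
  refine continuous_const.add (Continuous.const_smul ?_ s)
  exact continuous_matrix fun i j => continuous_jacobianMatrix_apply hX i j

lemma exists_abs_jacobianMatrix_le {N : ℕ}
    {X : EuclideanSpace ℝ (Fin N) → EuclideanSpace ℝ (Fin N)} (hX : ContDiff ℝ 1 X)
    (hc : HasCompactSupport X) :
    ∃ L : ℝ, 0 ≤ L ∧ ∀ x i j, |jacobianMatrix X x i j| ≤ L := by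
  obtain ⟨C, hC⟩ := (hc.fderiv ℝ).exists_bound_of_continuous (hX.continuous_fderiv one_ne_zero)
  refine ⟨C, (norm_nonneg _).trans (hC 0), fun x i j => ?_⟩
  calc |jacobianMatrix X x i j| ≤ ‖fderiv ℝ X x (EuclideanSpace.single j 1)‖ :=
        PiLp.norm_apply_le (fderiv ℝ X x (EuclideanSpace.single j 1)) i
    _ ≤ ‖fderiv ℝ X x‖ * ‖EuclideanSpace.single j (1 : ℝ)‖ := ContinuousLinearMap.le_opNorm _ _
    _ ≤ C := by simpa using hC x

/-- The volume of a convex body containing a ball of radius `r`, moved by the flow of a vector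
field of length at most one. -/
lemma setIntegral_det_one_add_smul_le {N : ℕ} {Ω : Set (EuclideanSpace ℝ (Fin N))}
    (ho : IsOpen Ω) (hconv : Convex ℝ Ω) (hb : Bornology.IsBounded Ω)
    {z : EuclideanSpace ℝ (Fin N)} {r : ℝ} (hr : 0 < r) (hball : Metric.ball z r ⊆ Ω)
    {X : EuclideanSpace ℝ (Fin N) → EuclideanSpace ℝ (Fin N)} (hX : ContDiff ℝ 1 X)
    (hX1 : ∀ x, ‖X x‖ ≤ 1) {K : NNReal} (hK : LipschitzWith K X) {s : ℝ} (hs : 0 < s)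
    (hsK : s * K < 1) :
    ∫ x in Ω, (1 + s • jacobianMatrix X x).det ≤ (1 + s / r) ^ N * volume.real Ω := by
  have hfin : volume Ω ≠ ⊤ := hb.measure_lt_top.ne
  set T : EuclideanSpace ℝ (Fin N) → EuclideanSpace ℝ (Fin N) := fun x => x + s • X x
  -- As `s K < 1`, the map `s X` is a strict contraction, so its perturbation of the identity is
  -- injective and the change of variables formula applies.
  have hinj : Function.Injective T := by
    intro x y hxy
    by_contra hne
    have h1 : x - y = s • (X y - X x) := by
      simp only [T] at hxy
      rw [smul_sub, sub_eq_sub_iff_add_eq_add, hxy, add_comm]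
    have h2 : ‖x - y‖ ≤ s * (K * ‖x - y‖) := by
      calc ‖x - y‖ = s * ‖X y - X x‖ := by rw [h1, norm_smul, Real.norm_of_nonneg hs.le]
        _ ≤ s * (K * ‖x - y‖) := by
          have := hK.dist_le_mul y x
          rw [dist_eq_norm, dist_eq_norm, ← norm_neg (y - x), neg_sub] at this
          gcongr
    have h3 : 0 < ‖x - y‖ := norm_pos_iff.2 (sub_ne_zero.2 hne)
    nlinarith
  have hder : ∀ x ∈ Ω, HasFDerivWithinAt T
      (ContinuousLinearMap.id ℝ (EuclideanSpace ℝ (Fin N)) + s • fderiv ℝ X x) Ω x := fun x _ =>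
    ((hasFDerivAt_id x).add
      (((hX.differentiable one_ne_zero) x).hasFDerivAt.const_smul s)).hasFDerivWithinAt
  have hcov := lintegral_abs_det_fderiv_eq_addHaar_image volume ho.measurableSet hder
    hinj.injOn
  have hq : 0 < 1 + s / r := by positivity
  -- With `q = 1 + s / r`, the point `x + s X(x)` is the dilation by `q` of the convex combination
  -- of `x` and `z + r X(x)` with weights `1 / q` and `(s / r) / q`. The second point lies in the
  -- closed ball, hence in `closure Ω`.
  have hsub : T '' Ω ⊆ AffineMap.homothety z (1 + s / r) '' Ω := by
    rintro _ ⟨x, hx, rfl⟩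
    have hw : z + r • X x ∈ closure Ω := by
      refine closure_mono hball ?_
      rw [closure_ball _ hr.ne', mem_closedBall_iff_norm, add_sub_cancel_left, norm_smul,
        Real.norm_of_nonneg hr.le]
      nlinarith [hX1 x]
    have hm := hconv.combo_interior_closure_mem_interior (ho.interior_eq.symm ▸ hx) hw
      (a := (1 + s / r)⁻¹) (b := (1 + s / r)⁻¹ * (s / r)) (by positivity) (by positivity)
      (by field_simp)
    refine ⟨_, interior_subset hm, ?_⟩
    rw [AffineMap.homothety_apply, vsub_eq_sub, vadd_eq_add, smul_sub, smul_add, smul_smul,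
      smul_smul, mul_inv_cancel_left₀ hq.ne', mul_inv_cancel₀ hq.ne', smul_add, smul_smul,
      div_mul_cancel₀ _ hr.ne', add_smul, one_smul, one_smul]
    simp only [T]
    abel
  have hle : ENNReal.ofReal (∫ x in Ω, (1 + s • jacobianMatrix X x).det) ≤
      ENNReal.ofReal ((1 + s / r) ^ N * volume.real Ω) := by
    calc ENNReal.ofReal (∫ x in Ω, (1 + s • jacobianMatrix X x).det)
        ≤ ∫⁻ x in Ω, ENNReal.ofReal |(1 + s • jacobianMatrix X x).det| := by
          refine (ENNReal.ofReal_le_ofReal (le_abs_self _)).trans ?_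
          rw [← Real.norm_eq_abs, ofReal_norm]
          refine (enorm_integral_le_lintegral_enorm _).trans (lintegral_mono fun x => ?_)
          rw [← Real.norm_eq_abs, ofReal_norm]
      _ = volume (T '' Ω) := by
          rw [← hcov]
          exact lintegral_congr fun x => by rw [det_one_add_smul_fderiv]
      _ ≤ volume (AffineMap.homothety z (1 + s / r) '' Ω) := measure_mono hsub
      _ = _ := by
          rw [Measure.addHaar_image_homothety, finrank_euclideanSpace, Fintype.card_fin,
            abs_of_nonneg (by positivity), ENNReal.ofReal_mul (by positivity),
            ofReal_measureReal hfin]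
  exact (ENNReal.ofReal_le_ofReal_iff (by positivity)).1 hle

/-- This is the first variation of the volume bound for the deformed set at `s = 0`: the left side
has derivative `∫_Ω div X`, by dominated convergence, and `(1 + s / r) ^ N` has derivative `N / r`.
-/
lemma mul_setIntegral_divergence_le {N : ℕ} {Ω : Set (EuclideanSpace ℝ (Fin N))}
    (ho : IsOpen Ω) (hconv : Convex ℝ Ω) (hb : Bornology.IsBounded Ω)
    {z : EuclideanSpace ℝ (Fin N)} {r : ℝ} (hr : 0 < r) (hball : Metric.ball z r ⊆ Ω)
    {X : EuclideanSpace ℝ (Fin N) → EuclideanSpace ℝ (Fin N)} (hX : ContDiff ℝ 1 X)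
    (hc : HasCompactSupport X) (hX1 : ∀ x, ‖X x‖ ≤ 1) :
    r * ∫ x in Ω, divergence X x ≤ N * volume.real Ω := by
  have hfin : volume Ω ≠ ⊤ := hb.measure_lt_top.ne
  have : IsFiniteMeasure (volume.restrict Ω) := ⟨by simpa using hb.measure_lt_top⟩
  obtain ⟨K, hK⟩ := ContDiff.lipschitzWith_of_hasCompactSupport hc hX one_ne_zero
  obtain ⟨L, hL, hJ⟩ := exists_abs_jacobianMatrix_le hX hc
  obtain ⟨D, hD⟩ := exists_abs_det_one_add_smul_sub_one_le (ι := Fin N) hL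
  have hcont : ∀ s : ℝ, Continuous fun x => ((1 + s • jacobianMatrix X x).det - 1) / s :=
    fun s => ((continuous_det_one_add_smul_jacobianMatrix hX s).sub continuous_const).div_const s
  have hbound : ∀ s ∈ Ioc (0 : ℝ) 1, ∀ x, ‖((1 + s • jacobianMatrix X x).det - 1) / s‖ ≤ D := by
    intro s hs x
    rw [norm_div, Real.norm_eq_abs, Real.norm_of_nonneg hs.1.le, div_le_iff₀ hs.1]
    exact hD _ (hJ x) s ⟨hs.1.le, hs.2⟩
  have hev : ∀ᶠ s : ℝ in 𝓝[>] 0, s ∈ Ioc (0 : ℝ) 1 := Ioc_mem_nhdsGT zero_lt_one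
  have t1 : Tendsto (fun s : ℝ => ∫ x in Ω, ((1 + s • jacobianMatrix X x).det - 1) / s) (𝓝[>] 0)
      (𝓝 (∫ x in Ω, divergence X x)) := by
    refine tendsto_integral_filter_of_dominated_convergence (fun _ => D)
      (Eventually.of_forall fun s => (hcont s).aestronglyMeasurable) ?_ (integrable_const _)
      (Eventually.of_forall fun x => tendsto_det_one_add_smul_sub_one_div _)
    filter_upwards [hev] with s hs using Eventually.of_forall (hbound s hs)
  have t2 : Tendsto (fun s : ℝ => ((1 + s / r) ^ N - 1) / s * volume.real Ω) (𝓝[>] 0)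
      (𝓝 (N * r⁻¹ * volume.real Ω)) := by
    refine Tendsto.mul_const _ ?_
    have hd : HasDerivAt (fun s : ℝ => (1 + s / r) ^ N) (N * r⁻¹) 0 := by
      have := (((hasDerivAt_id (0 : ℝ)).div_const r).const_add 1).fun_pow N
      simpa using this
    have := (hasDerivAt_iff_tendsto_slope.1 hd).mono_left
      (nhdsWithin_mono 0 (fun s (hs : 0 < s) => ne_of_gt hs))
    refine this.congr fun s => ?_
    simp [slope_def_field]
  have hsK : ∀ᶠ s : ℝ in 𝓝[>] 0, s * K < 1 := by
    have : Continuous fun s : ℝ => s * K := by fun_prop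
    exact (this.tendsto' 0 0 (by simp)).mono_left nhdsWithin_le_nhds |>.eventually_lt_const
      zero_lt_one
  have hfinal := le_of_tendsto_of_tendsto t1 t2 (by
    filter_upwards [hev, hsK] with s hs hs'
    have h := setIntegral_det_one_add_smul_le ho hconv hb hr hball hX hX1 hK hs.1 hs'
    have hi : IntegrableOn (fun x => ((1 + s • jacobianMatrix X x).det - 1) / s) Ω :=
      Integrable.of_bound (hcont s).aestronglyMeasurable D (Eventually.of_forall (hbound s hs))
    have e : ∫ x in Ω, (1 + s • jacobianMatrix X x).det =
        s * (∫ x in Ω, ((1 + s • jacobianMatrix X x).det - 1) / s) + volume.real Ω := by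
      rw [← integral_const_mul]
      have : volume.real Ω = ∫ x in Ω, (1 : ℝ) := by simp
      rw [this, ← integral_add (hi.const_mul s) (integrable_const _)]
      refine integral_congr_ae (Eventually.of_forall fun x => ?_)
      have := hs.1.ne'
      simp only
      field_simp
      ring
    rw [e] at h
    rw [div_mul_eq_mul_div, le_div_iff₀ hs.1]
    linarith)
  calc _ ≤ r * (N * r⁻¹ * volume.real Ω) := by gcongr
    _ = _ := by field_simp

/-- A convex body containing a ball of radius `r` has `r P(Ω) ≤ N |Ω|`. -/
lemma perimeter_mul_le {N : ℕ} {Ω : Set (EuclideanSpace ℝ (Fin N))}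
    (ho : IsOpen Ω) (hconv : Convex ℝ Ω) (hb : Bornology.IsBounded Ω)
    {z : EuclideanSpace ℝ (Fin N)} {r : ℝ} (hr : 0 < r) (hball : Metric.ball z r ⊆ Ω) :
    perimeter Ω * ENNReal.ofReal r ≤ N * volume Ω := by
  rw [perimeter, ENNReal.iSup_mul]
  refine iSup_le fun X => ?_
  rw [ENNReal.iSup_mul]
  refine iSup_le fun ⟨hX, hc, hX1⟩ => ?_
  rw [mul_comm, ← ENNReal.ofReal_mul hr.le]
  refine (ENNReal.ofReal_le_ofReal
    (mul_setIntegral_divergence_le ho hconv hb hr hball hX hc hX1)).trans ?_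
  rw [ENNReal.ofReal_mul (by positivity), ofReal_measureReal hb.measure_lt_top.ne,
    ENNReal.ofReal_natCast]

/-! ### Circumscribed polytopes -/

/-- Off its frontier, `u` and the complement of its closure separate the space, and a preconnected
set cannot meet both. -/
lemma isPreconnected_subset_of_disjoint_frontier {α : Type*} [TopologicalSpace α] {s u : Set α}
    (hs : IsPreconnected s) (hu : IsOpen u) (hne : (s ∩ u).Nonempty)
    (hd : Disjoint s (frontier u)) : s ⊆ u := by
  refine IsPreconnected.subset_left_of_subset_union hu isClosed_closure.isOpen_compl
    (disjoint_compl_right_iff_subset.2 subset_closure) (fun x hx => ?_) hne hs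
  by_cases hxu : x ∈ u
  · exact Or.inl hxu
  · refine Or.inr fun hcl => disjoint_left.1 hd hx ?_
    rw [hu.frontier_eq]
    exact ⟨hcl, hxu⟩

/-- A bounded convex open set is approximated from outside by polytopes, with unit normals. -/
lemma exists_polytope {N : ℕ} {Ω : Set (EuclideanSpace ℝ (Fin N))}
    (ho : IsOpen Ω) (hconv : Convex ℝ Ω) (hb : Bornology.IsBounded Ω)
    {z : EuclideanSpace ℝ (Fin N)} (hz : z ∈ Ω) {q : ℝ} (hq : 1 < q) :
    ∃ (m : ℕ) (a : Fin m → EuclideanSpace ℝ (Fin N)) (b : Fin m → ℝ), (∀ i, ‖a i‖ = 1) ∧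
      (∀ x ∈ Ω, ∀ i, inner ℝ (a i) x < b i) ∧
      ∀ x, (∀ i, inner ℝ (a i) x < b i) → x ∈ AffineMap.homothety z q '' Ω := by
  have hq0 : q ≠ 0 := by positivity
  set G := AffineMap.homothety z q '' Ω
  have hGo : IsOpen G := AffineMap.homothety_isOpenMap z q hq0 _ ho
  have hGb : Bornology.IsBounded G := by
    have : G ⊆ (fun x => q • (x - z) + z) '' closure Ω := by
      rintro _ ⟨x, hx, rfl⟩
      exact ⟨x, subset_closure hx, by simp [AffineMap.homothety_apply]⟩
    refine (IsCompact.isBounded ?_).subset this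
    exact hb.isCompact_closure.image (by fun_prop)
  have hcl : closure Ω ⊆ G := by
    have := hconv.closure_subset_image_homothety_interior_of_one_lt
      (ho.interior_eq.symm ▸ hz) q hq
    rwa [ho.interior_eq] at this
  have hcomp : IsCompact (frontier G) :=
    hGb.isCompact_closure.of_isClosed_subset isClosed_frontier frontier_subset_closure
  -- Each frontier point of the dilated body is cut off from `closure Ω` by a hyperplane; by
  -- compactness finitely many such hyperplanes suffice.
  have hsep : ∀ y : frontier G, ∃ (f : EuclideanSpace ℝ (Fin N) →L[ℝ] ℝ) (u : ℝ),
      (∀ x ∈ closure Ω, f x < u) ∧ u < f y := fun y => by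
    refine geometric_hahn_banach_closed_point hconv.closure isClosed_closure fun hy => ?_
    exact (hGo.frontier_eq.subset y.2).2 (hcl hy)
  choose f u hf hfu using hsep
  obtain ⟨t, ht⟩ := hcomp.elim_finite_subcover (fun y : frontier G => {x | u y < f y x})
    (fun y => isOpen_lt continuous_const (f y).continuous)
    fun y hy => mem_iUnion.2 ⟨⟨y, hy⟩, hfu _⟩
  set e := t.equivFin.symm
  set v : frontier G → EuclideanSpace ℝ (Fin N) := fun y =>
    (InnerProductSpace.toDual ℝ (EuclideanSpace ℝ (Fin N))).symm (f y)
  have hv : ∀ y x, inner ℝ (v y) x = f y x := fun y x => by simp [v]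
  have hv0 : ∀ y, 0 < ‖v y‖ := fun y => by
    refine norm_pos_iff.2 fun h => ?_
    have h1 := hf y z (subset_closure hz)
    have h2 := hfu y
    rw [← hv, h, inner_zero_left] at h1 h2
    linarith
  have hiff : ∀ y x, inner ℝ (‖v y‖⁻¹ • v y) x < ‖v y‖⁻¹ * u y ↔ f y x < u y := fun y x => by
    rw [real_inner_smul_left, hv, mul_lt_mul_iff_right₀ (inv_pos.2 (hv0 y))]
  refine ⟨t.card, fun i => ‖v (e i)‖⁻¹ • v (e i), fun i => ‖v (e i)‖⁻¹ * u (e i), fun i => ?_,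
    fun x hx i => (hiff _ x).2 (hf _ x (subset_closure hx)), ?_⟩
  · rw [norm_smul, norm_inv, norm_norm, inv_mul_cancel₀ (hv0 _).ne']
  -- Every frontier point of `G` violates one of the chosen constraints, so the convex set `Q`
  -- avoids the frontier; it contains `z ∈ G`, hence lies in `G`.
  · set Q := ⋂ i, {x : EuclideanSpace ℝ (Fin N) | f (e i) x < u (e i)}
    have hQc : Convex ℝ Q :=
      convex_iInter fun i => convex_halfSpace_lt (f (e i)).isLinear _
    have hQG : Q ⊆ G := by
      refine isPreconnected_subset_of_disjoint_frontier hQc.isPreconnected hGo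
        ⟨z, mem_iInter.2 fun i => hf _ z (subset_closure hz), hcl (subset_closure hz)⟩ ?_
      refine disjoint_left.2 fun x hx hxG => ?_
      obtain ⟨y, hy, hxy⟩ := mem_iUnion₂.1 (ht hxG)
      have := mem_iInter.1 hx (e.symm ⟨y, hy⟩)
      rw [mem_ofPred_eq, Equiv.apply_symm_apply] at this
      exact lt_asymm this hxy
    intro x hx
    exact hQG (mem_iInter.2 fun i => (hiff _ x).1 (hx i))

/-! ### Slicing and Hersch's inequality -/

/-- Fubini's theorem along the direction of a unit vector. -/
lemma exists_lintegral_eq_lintegral_lines {n : ℕ} (a : EuclideanSpace ℝ (Fin (n + 1)))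
    (ha : ‖a‖ = 1) :
    ∃ L : (Fin n → ℝ) → EuclideanSpace ℝ (Fin (n + 1)), Measurable L ∧
      (∀ y, inner ℝ a (L y) = 0) ∧
      ∀ f : EuclideanSpace ℝ (Fin (n + 1)) → ℝ≥0∞, Measurable f →
        ∫⁻ x, f x = ∫⁻ y, ∫⁻ t : ℝ, f (L y + t • a) := by
  -- Complete `a` to an orthonormal basis with `a` in position zero; its coordinates preserve
  -- volume, and `L` parametrises the hyperplane orthogonal to `a`.
  obtain ⟨B, hB⟩ : ∃ B : OrthonormalBasis (Fin (n + 1)) ℝ (EuclideanSpace ℝ (Fin (n + 1))),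
      ∀ i ∈ ({0} : Set (Fin (n + 1))), B i = (fun _ => a) i := by
    refine Orthonormal.exists_orthonormalBasis_extension_of_card_eq (by simp) ?_
    refine ⟨fun i => ha, fun i j hij => (hij (Subsingleton.elim i j)).elim⟩
  have hB0 : B 0 = a := hB 0 rfl
  set Φ : (Fin (n + 1) → ℝ) → EuclideanSpace ℝ (Fin (n + 1)) := fun c =>
    B.repr.symm (WithLp.toLp 2 c)
  have hΦ : MeasurePreserving Φ volume volume :=
    B.measurePreserving_repr_symm.comp (PiLp.volume_preserving_toLp _)
  have hsplit := (volume_preserving_piFinSuccAbove (fun _ : Fin (n + 1) => ℝ) 0).symm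
  have hΦc : ∀ (t : ℝ) (y : Fin n → ℝ),
      Φ (Fin.cons t y) = Φ (Fin.cons 0 y) + t • a := by
    intro t y
    simp only [Φ]
    rw [← hB0, ← B.repr_symm_single, ← map_smul, ← map_add]
    congr 1
    ext i
    refine Fin.cases ?_ (fun i => ?_) i <;> simp
  refine ⟨fun y => Φ (Fin.cons 0 y), ?_, fun y => ?_, fun f hf => ?_⟩
  · refine hΦ.measurable.comp (measurable_pi_iff.2 fun i => ?_)
    refine Fin.cases ?_ (fun i => ?_) i
    · simp
    · simpa using measurable_pi_apply i
  · simp only [Φ]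
    rw [← hB0, ← B.repr_apply_apply]
    simp
  · rw [← hΦ.lintegral_comp hf, ← hsplit.lintegral_comp (f := fun c => f (Φ c)) (hf.comp hΦ.measurable),
      Measure.volume_eq_prod, lintegral_prod_symm]
    · refine lintegral_congr fun y => lintegral_congr fun t => ?_
      rw [← hΦc]
      congr 2
      simp [MeasurableEquiv.piFinSuccAbove]
      rfl
    · exact ((hf.comp hΦ.measurable).comp hsplit.measurable).aemeasurable

/-- Poincaré inequality on a set made of segments orthogonal to a hyperplane on which the function
vanishes. -/
lemma poincarePi_rpow_mul_lintegral_strip_le {n : ℕ} {p : ℝ} (hp : 1 < p)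
    {a : EuclideanSpace ℝ (Fin (n + 1))} (ha : ‖a‖ = 1) {b ρ : ℝ}
    {S : Set (EuclideanSpace ℝ (Fin (n + 1)))} (hS : MeasurableSet S)
    (hρ : ∀ x ∈ S, b - inner ℝ a x ∈ Ioc 0 ρ)
    (hray : ∀ x ∈ S, ∀ s, 0 ≤ s → s < b - inner ℝ a x → x + s • a ∈ S)
    {u : EuclideanSpace ℝ (Fin (n + 1)) → ℝ} (hu : ContDiff ℝ 1 u)
    (h0 : ∀ x, inner ℝ a x = b → u x = 0) :
    poincarePi p ^ p * ∫⁻ x in S, ‖u x‖ₑ ^ p ≤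
      ENNReal.ofReal (2 * ρ) ^ p * ∫⁻ x in S, ‖gradient u x‖ₑ ^ p := by
  have hp0 : 0 < p := by linarith
  obtain ⟨L, hL, hLa, hfub⟩ := exists_lintegral_eq_lintegral_lines a ha
  have hgc : Continuous (gradient u) :=
    (InnerProductSpace.toDual ℝ _).symm.continuous.comp (hu.continuous_fderiv one_ne_zero)
  -- Lines are parametrised by the distance `t = b - ⟪a, x⟫` to the hyperplane, so that `u` vanishes
  -- at `t = 0` and each slice of `S` is an initial segment.
  have hline : ∀ f : EuclideanSpace ℝ (Fin (n + 1)) → ℝ≥0∞, Measurable f →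
      ∫⁻ x in S, f x =
        ∫⁻ y, ∫⁻ t in {t : ℝ | L y + (b - t) • a ∈ S}, f (L y + (b - t) • a) := by
    intro f hf
    rw [← lintegral_indicator hS, hfub _ (hf.indicator hS)]
    refine lintegral_congr fun y => ?_
    have hm : MeasurableSet {t : ℝ | L y + (b - t) • a ∈ S} :=
      (show Measurable fun t : ℝ => L y + (b - t) • a by fun_prop) hS
    rw [← lintegral_sub_left_eq_self _ b, ← lintegral_indicator hm]
    rfl
  have hinner : ∀ y (t : ℝ), inner ℝ a (L y + t • a) = t := fun y t => by
    rw [inner_add_right, hLa, real_inner_smul_right, real_inner_self_eq_norm_sq, ha]; ring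
  have hmu : Measurable fun x => ‖u x‖ₑ ^ p := (hu.continuous.measurable.enorm).pow_const _
  have hmg : Measurable fun x => ‖gradient u x‖ₑ ^ p := (hgc.measurable.enorm).pow_const _
  rw [hline _ hmu, hline _ hmg]
  -- The right constant is finite and can be moved inside. On the left, where `π_p` may be infinite,
  -- the inequality `lintegral_const_mul_le` suffices.
  rw [← lintegral_const_mul' _ _ (ENNReal.rpow_ne_top_of_nonneg hp0.le ENNReal.ofReal_ne_top)]
  refine (lintegral_const_mul_le _ _).trans (lintegral_mono fun y => ?_)
  have hw : ContDiff ℝ 1 fun t : ℝ => u (L y + (b - t) • a) := hu.comp (by fun_prop)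
  have h := poincarePi_rpow_mul_setLIntegral_le hp hw
    (by simp only [sub_zero]; exact h0 _ (hinner y b)) (ρ := ρ)
    (S := {t : ℝ | L y + (b - t) • a ∈ S})
    (fun t ht => by simpa [hinner] using hρ _ ht)
    (fun t ht s hs => by
      have := hray _ ht (t - s) (by linarith [hs.2]) (by rw [hinner]; linarith [hs.1])
      rw [add_assoc, ← add_smul] at this
      simpa using this)
  refine h.trans ?_
  gcongr with t
  have hd : deriv (fun t : ℝ => u (L y + (b - t) • a)) t =
      inner ℝ (gradient u (L y + (b - t) • a)) (-a) := by
    have h1 : HasDerivAt (fun t : ℝ => L y + (b - t) • a) (-a) t := by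
      simpa using (((hasDerivAt_id t).const_sub b).smul_const a).const_add (L y)
    have h2 := (((hu.differentiable one_ne_zero) (L y + (b - t) • a)).hasFDerivAt).comp_hasDerivAt
      t h1
    rw [gradient, InnerProductSpace.toDual_symm_apply]
    exact h2.deriv
  rw [hd, ← ofReal_norm, ← ofReal_norm]
  refine ENNReal.ofReal_le_ofReal ((norm_inner_le_norm _ _).trans ?_)
  rw [norm_neg, ha, mul_one]

lemma lintegral_rpow_ne_zero {N : ℕ} {p : ℝ} {Ω : Set (EuclideanSpace ℝ (Fin N))}
    (hp : 0 < p) (ho : IsOpen Ω) {u : EuclideanSpace ℝ (Fin N) → ℝ} (hu : Continuous u)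
    (hs : tsupport u ⊆ Ω) (hne : u ≠ 0) : ∫⁻ x in Ω, ‖u x‖ₑ ^ p ≠ 0 := by
  obtain ⟨x, hx⟩ := Function.ne_iff.1 hne
  have hopen : IsOpen (Function.support u) := hu.isOpen_support
  have hpos : 0 < volume (Function.support u) := hopen.measure_pos _ ⟨x, hx⟩
  have hsub : Function.support u ⊆ Ω := (subset_tsupport u).trans hs
  have hsupp : (Function.support fun x => ‖u x‖ₑ ^ p) = Function.support u := by
    ext x; simp [hp, hp.not_gt]
  refine (lintegral_pos_iff_support ((hu.measurable.enorm).pow_const _)).2 ?_ |>.ne'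
  rw [hsupp, Measure.restrict_apply' ho.measurableSet, inter_eq_left.2 hsub]
  exact hpos

lemma lintegral_rpow_ne_top {N : ℕ} {p : ℝ} {Ω : Set (EuclideanSpace ℝ (Fin N))}
    (hp : 0 < p) (hb : Bornology.IsBounded Ω) {u : EuclideanSpace ℝ (Fin N) → ℝ}
    (hu : Continuous u) (hc : HasCompactSupport u) : ∫⁻ x in Ω, ‖u x‖ₑ ^ p ≠ ⊤ := by
  obtain ⟨C, hC⟩ := hc.exists_bound_of_continuous hu
  refine ne_top_of_le_ne_top ?_ (lintegral_mono (g := fun _ => ENNReal.ofReal C ^ p) fun x => ?_)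
  · rw [lintegral_const]
    refine ENNReal.mul_ne_top (ENNReal.rpow_ne_top_of_nonneg hp.le ENNReal.ofReal_ne_top) ?_
    simpa using hb.measure_lt_top.ne
  · rw [← ofReal_norm]
    exact ENNReal.rpow_le_rpow (ENNReal.ofReal_le_ofReal (hC x)) hp.le

/-- An upper bound for the radii of the balls in a set scales under homotheties. -/
lemma le_of_ball_subset_homothety {E : Type*} [NormedAddCommGroup E] [NormedSpace ℝ E] {Ω : Set E}
    {R : ℝ} (hR : ∀ x r, 0 < r → Metric.ball x r ⊆ Ω → r ≤ R) {z x : E} {q d : ℝ} (hq : 0 < q)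
    (hd : 0 < d) (hball : Metric.ball x d ⊆ AffineMap.homothety z q '' Ω) : d ≤ q * R := by
  rw [← div_le_iff₀' hq]
  refine hR (AffineMap.homothety z q⁻¹ x) _ (by positivity) fun y hy => ?_
  have h1 : AffineMap.homothety z q y - x =
      q • (y - AffineMap.homothety z q⁻¹ x) := by
    simp only [AffineMap.homothety_apply, vsub_eq_sub, vadd_eq_add, smul_sub, smul_add, smul_smul,
      mul_inv_cancel₀ hq.ne', one_smul]
    abel
  have h2 : AffineMap.homothety z q y ∈ Metric.ball x d := by
    rw [mem_ball_iff_norm, h1, norm_smul, Real.norm_of_nonneg hq.le]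
    rw [mem_ball_iff_norm, lt_div_iff₀' hq] at hy
    exact hy
  obtain ⟨w, hw, hwy⟩ := hball h2
  have : w = y := by
    simp only [AffineMap.homothety_apply, vsub_eq_sub, vadd_eq_add, add_left_inj] at hwy
    exact sub_left_injective (smul_right_injective E hq.ne' hwy)
  exact this ▸ hw

/-- Hersch's inequality, with the inradius of a circumscribed polytope. -/
lemma poincarePi_rpow_mul_lintegral_le_of_inradius {n : ℕ} {p : ℝ} (hp : 1 < p)
    {Ω : Set (EuclideanSpace ℝ (Fin (n + 1)))} (ho : IsOpen Ω) (hconv : Convex ℝ Ω)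
    (hb : Bornology.IsBounded Ω) (hne : Ω.Nonempty) {R : ℝ}
    (hR : ∀ x r, 0 < r → Metric.ball x r ⊆ Ω → r ≤ R) {q : ℝ} (hq : 1 < q)
    {u : EuclideanSpace ℝ (Fin (n + 1)) → ℝ} (hu : ContDiff ℝ 1 u) (hs : tsupport u ⊆ Ω) :
    poincarePi p ^ p * ∫⁻ x in Ω, ‖u x‖ₑ ^ p ≤
      ENNReal.ofReal (2 * (q * R)) ^ p * ∫⁻ x in Ω, ‖gradient u x‖ₑ ^ p := by
  have hp0 : 0 < p := by linarith
  obtain ⟨z, hz⟩ := hne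
  obtain ⟨m, a, b, ha, hΩ, hQ⟩ := exists_polytope ho hconv hb hz hq
  set d : Fin m → EuclideanSpace ℝ (Fin (n + 1)) → ℝ := fun i x => b i - inner ℝ (a i) x
  have hdc : ∀ i, Measurable (d i) := fun i => by fun_prop
  have hdpos : ∀ x ∈ Ω, ∀ i, 0 < d i x := fun x hx i => sub_pos.2 (hΩ x hx i)
  -- The normals are unit vectors, so a ball about `x` of radius at most every `d i x` lies in the
  -- polytope, hence in the dilated body.
  have hinr : ∀ x r, 0 < r → (∀ i, r ≤ d i x) → r ≤ q * R := by
    intro x r hr hrd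
    refine le_of_ball_subset_homothety hR (z := z) (x := x) (by linarith) hr fun y hy => hQ y fun i => ?_
    have h1 : inner ℝ (a i) (y - x) ≤ ‖y - x‖ := by
      have := real_inner_le_norm (a i) (y - x)
      rwa [ha, one_mul] at this
    rw [mem_ball_iff_norm] at hy
    rw [inner_sub_right] at h1
    have := hrd i
    simp only [d] at this
    linarith
  -- With no facet the polytope would be the whole space, contradicting the bound on inscribed
  -- radii.
  have hm : Nonempty (Fin m) := by
    by_contra hem
    have hR0 : 0 < R := by
      obtain ⟨ε, hε, hε'⟩ := Metric.isOpen_iff.1 ho z hz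
      exact hε.trans_le (hR z ε hε hε')
    have := hinr z (q * R + 1) (by positivity) fun i => (hem ⟨i⟩).elim
    linarith
  -- The cell of facet `i`: points of the polytope nearest to it, ties going to the smallest index
  -- so that the cells are disjoint.
  set Q : Fin m → Set (EuclideanSpace ℝ (Fin (n + 1))) := fun i =>
    {x | (∀ j, 0 < d j x) ∧ (∀ j < i, d i x < d j x) ∧ ∀ j, d i x ≤ d j x}
  have hQm : ∀ i, MeasurableSet (Q i) := by
    intro i
    simp only [Q, measurableSet_setOfPred]
    refine Measurable.and (Measurable.forall fun j => ?_)
      (Measurable.and (Measurable.forall fun j => Measurable.imp ?_ ?_)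
        (Measurable.forall fun j => ?_))
    · exact measurableSet_setOfPred.1 (measurableSet_lt measurable_const (hdc j))
    · exact measurable_const
    · exact measurableSet_setOfPred.1 (measurableSet_lt (hdc i) (hdc j))
    · exact measurableSet_setOfPred.1 (measurableSet_le (hdc i) (hdc j))
  have hQd : Pairwise (Function.onFun Disjoint Q) := by
    have : ∀ i j, i < j → Disjoint (Q i) (Q j) := fun i j hij =>
      disjoint_left.2 fun x hxi hxj => (hxj.2.1 i hij).not_ge (hxi.2.2 j)
    intro i j hij
    rcases lt_or_gt_of_ne hij with h | h
    · exact this i j h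
    · exact (this j i h).symm
  have hcover : Ω ⊆ ⋃ i, Q i := by
    intro x hx
    obtain ⟨i0, hi0⟩ := Finite.exists_min fun i => d i x
    have hex : {i | ∀ j, d i x ≤ d j x}.Nonempty := ⟨i0, hi0⟩
    obtain ⟨i, hi, himin⟩ := WellFounded.has_min (wellFounded_lt (α := Fin m)) _ hex
    refine mem_iUnion.2 ⟨i, hdpos x hx, fun j hj => ?_, hi⟩
    refine lt_of_le_of_ne (hi j) fun heq => himin j (fun k => ?_) hj
    rw [← heq]
    exact hi k
  have hsupp : ∫⁻ x in ⋃ i, Q i, ‖gradient u x‖ₑ ^ p ≤ ∫⁻ x in Ω, ‖gradient u x‖ₑ ^ p := by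
    refine (setLIntegral_le_lintegral _ _).trans (le_of_eq ?_)
    rw [← lintegral_indicator ho.measurableSet]
    refine lintegral_congr fun x => ?_
    by_cases hx : x ∈ Ω
    · rw [indicator_of_mem hx]
    · have : fderiv ℝ u x = 0 := by
        have : x ∉ tsupport (fderiv ℝ u) := fun h => hx (hs (tsupport_fderiv_subset ℝ h))
        exact image_eq_zero_of_notMem_tsupport this
      rw [indicator_of_notMem hx, gradient, this]
      simp [hp0]
  have hstrip : ∀ i, poincarePi p ^ p * ∫⁻ x in Q i, ‖u x‖ₑ ^ p ≤
      ENNReal.ofReal (2 * (q * R)) ^ p * ∫⁻ x in Q i, ‖gradient u x‖ₑ ^ p := by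
    intro i
    refine poincarePi_rpow_mul_lintegral_strip_le hp (ha i) (hQm i)
      (fun x hx => ⟨hx.1 i, hinr x _ (hx.1 i) hx.2.2⟩) (fun x hx s hs0 hsd => ?_) hu fun x hx => ?_
    -- Moving by `s` towards facet `i` lowers `d i` by exactly `s` and every other `d j` by at most
    -- `s`, so facet `i` remains the nearest and the point stays in its cell.
    · have hmove : ∀ j, d j (x + s • a i) = d j x - s * inner ℝ (a j) (a i) := fun j => by
        simp only [d, inner_add_right, real_inner_smul_right]; ring
      have hself : inner ℝ (a i) (a i) = 1 := by
        rw [real_inner_self_eq_norm_sq, ha]; norm_num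
      have hle : ∀ j, s * inner ℝ (a j) (a i) ≤ s := fun j => by
        have := real_inner_le_norm (a j) (a i)
        rw [ha, ha, one_mul] at this
        exact mul_le_of_le_one_right hs0 this
      have hi : d i (x + s • a i) = d i x - s := by rw [hmove, hself, mul_one]
      have hpos : 0 < d i x - s := sub_pos.2 hsd
      refine ⟨fun j => ?_, fun j hj => ?_, fun j => ?_⟩
      · rw [hmove]; linarith [hle j, hx.2.2 j]
      · rw [hi, hmove]; linarith [hle j, hx.2.1 j hj]
      · rw [hi, hmove]; linarith [hle j, hx.2.2 j]
    -- The facet hyperplane misses `Ω`, which contains the support of `u`.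
    · refine image_eq_zero_of_notMem_tsupport fun h => ?_
      exact (hΩ x (hs h) i).ne hx
  calc poincarePi p ^ p * ∫⁻ x in Ω, ‖u x‖ₑ ^ p
      ≤ poincarePi p ^ p * ∫⁻ x in ⋃ i, Q i, ‖u x‖ₑ ^ p := by
        gcongr
    _ = ∑ i, poincarePi p ^ p * ∫⁻ x in Q i, ‖u x‖ₑ ^ p := by
        rw [lintegral_iUnion hQm hQd, tsum_fintype, Finset.mul_sum]
    _ ≤ ∑ i, ENNReal.ofReal (2 * (q * R)) ^ p * ∫⁻ x in Q i, ‖gradient u x‖ₑ ^ p :=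
        Finset.sum_le_sum fun i _ => hstrip i
    _ = ENNReal.ofReal (2 * (q * R)) ^ p * ∫⁻ x in ⋃ i, Q i, ‖gradient u x‖ₑ ^ p := by
        rw [lintegral_iUnion hQm hQd, tsum_fintype, Finset.mul_sum]
    _ ≤ _ := by gcongr

/-! ### The lower bound for convex sets -/

lemma perimeter_ne_top {N : ℕ} {Ω : Set (EuclideanSpace ℝ (Fin N))}
    (ho : IsOpen Ω) (hconv : Convex ℝ Ω) (hb : Bornology.IsBounded Ω) (hne : Ω.Nonempty) :
    perimeter Ω ≠ ⊤ := by
  obtain ⟨z, hz⟩ := hne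
  obtain ⟨ε, hε, hball⟩ := Metric.isOpen_iff.1 ho z hz
  have h := perimeter_mul_le ho hconv hb hε hball
  intro htop
  rw [htop, ENNReal.top_mul (by simpa using hε)] at h
  exact (ENNReal.mul_ne_top (ENNReal.natCast_ne_top N) hb.measure_lt_top.ne) (top_le_iff.1 h)

/-- The lower bound for the first eigenvalue in terms of the isoperimetric ratio. -/
theorem le_firstEigenvalue {N : ℕ} (hN : 1 ≤ N) {p : ℝ} (hp : 1 < p)
    {Ω : Set (EuclideanSpace ℝ (Fin N))} (ho : IsOpen Ω) (hconv : Convex ℝ Ω)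
    (hb : Bornology.IsBounded Ω) (hne : Ω.Nonempty) :
    (poincarePi p / (2 * (N : ℝ≥0∞))) ^ p * (perimeter Ω / volume Ω) ^ p ≤
      firstEigenvalue p Ω := by
  have hp0 : 0 < p := by linarith
  have hV0 : volume Ω ≠ 0 := (ho.measure_pos volume hne).ne'
  have hVt : volume Ω ≠ ⊤ := hb.measure_lt_top.ne
  have hPt : perimeter Ω ≠ ⊤ := perimeter_ne_top ho hconv hb hne
  have hN0 : (N : ℝ≥0∞) ≠ 0 := by exact_mod_cast (by omega)
  have hNt : (N : ℝ≥0∞) ≠ ⊤ := ENNReal.natCast_ne_top N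
  by_cases hP0 : perimeter Ω = 0
  · simp [hP0, hp0]
  refine le_iInf₂ fun u ⟨hu, hc, hs, hu0⟩ => ?_
  have hu1 : ContDiff ℝ 1 u := hu.of_le (by exact_mod_cast le_top)
  rw [ENNReal.le_div_iff_mul_le
    (Or.inl (lintegral_rpow_ne_zero hp0 ho hu.continuous hs hu0))
    (Or.inl (lintegral_rpow_ne_top hp0 hb hu.continuous hc))]
  -- The bound on inscribed radii given by the perimeter inequality; it replaces the inradius in
  -- Hersch's inequality.
  set R : ℝ≥0∞ := N * volume Ω / perimeter Ω
  have hRt : R ≠ ⊤ := ENNReal.div_ne_top (ENNReal.mul_ne_top hNt hVt) hP0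
  have hR0 : R ≠ 0 := ENNReal.div_ne_zero.2 ⟨mul_ne_zero hN0 hV0, hPt⟩
  have hinr : ∀ x r, 0 < r → Metric.ball x r ⊆ Ω → r ≤ R.toReal := by
    intro x r hr hball
    rw [← ENNReal.ofReal_le_iff_le_toReal hRt, ENNReal.le_div_iff_mul_le (Or.inl hP0) (Or.inl hPt),
      mul_comm]
    exact perimeter_mul_le ho hconv hb hr hball
  -- Let the dilation ratio `q` of the circumscribed polytopes decrease to one.
  have hlim : poincarePi p ^ p * ∫⁻ x in Ω, ‖u x‖ₑ ^ p ≤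
      (2 * R) ^ p * ∫⁻ x in Ω, ‖gradient u x‖ₑ ^ p := by
    have hcont : Continuous fun q : ℝ => ENNReal.ofReal (2 * (q * R.toReal)) ^ p :=
      ENNReal.continuous_rpow_const.comp (ENNReal.continuous_ofReal.comp (by fun_prop))
    have h1 : ENNReal.ofReal (2 * (1 * R.toReal)) ^ p = (2 * R) ^ p := by
      rw [one_mul, ENNReal.ofReal_mul zero_le_two, ENNReal.ofReal_toReal hRt]; norm_num
    have t : Tendsto (fun q : ℝ => ENNReal.ofReal (2 * (q * R.toReal)) ^ p *
        ∫⁻ x in Ω, ‖gradient u x‖ₑ ^ p) (𝓝[>] 1)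
        (𝓝 ((2 * R) ^ p * ∫⁻ x in Ω, ‖gradient u x‖ₑ ^ p)) := by
      refine ENNReal.Tendsto.mul_const ?_ (Or.inl ?_)
      · rw [← h1]
        exact (hcont.tendsto 1).mono_left nhdsWithin_le_nhds
      · simp [ENNReal.rpow_eq_zero_iff, hR0, hp0, hp0.not_gt]
    refine ge_of_tendsto t ?_
    filter_upwards [self_mem_nhdsWithin] with q hq
    obtain ⟨n, rfl⟩ : ∃ n, N = n + 1 := ⟨N - 1, by omega⟩
    exact poincarePi_rpow_mul_lintegral_le_of_inradius hp ho hconv hb hne hinr hq hu1 hs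
  have hconst : poincarePi p / (2 * (N : ℝ≥0∞)) * (perimeter Ω / volume Ω) =
      poincarePi p / (2 * R) := by
    have : (2 * R)⁻¹ = (2 * (N : ℝ≥0∞))⁻¹ * (perimeter Ω / volume Ω) := by
      simp only [R]
      rw [ENNReal.mul_inv (by simp) (by simp), ENNReal.mul_inv (by simp) (by simp),
        ENNReal.inv_div (Or.inl hPt) (Or.inl hP0), mul_assoc, div_eq_mul_inv, div_eq_mul_inv,
        ENNReal.mul_inv (Or.inl hN0) (Or.inl hNt)]
      ring
    rw [div_eq_mul_inv _ (2 * R), this, div_eq_mul_inv, mul_assoc]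
  rw [← ENNReal.mul_rpow_of_nonneg _ _ hp0.le, hconst, ENNReal.div_rpow_of_nonneg _ _ hp0.le,
    div_eq_mul_inv, mul_right_comm, ← div_eq_mul_inv]
  exact ENNReal.div_le_of_le_mul' hlim

/-! ### Geometry of the collapsing pyramids -/

lemma collapsingPyramid_eq (n : ℕ) {α : ℝ} (hα : 0 < α) :
    collapsingPyramid (n + 1) α = {x | 0 < x (Fin.last n) ∧ x (Fin.last n) < α ∧
      ∀ i, i ≠ Fin.last n → |x i| < 1 - x (Fin.last n) / α} := by
  have hlt : ∀ i : Fin (n + 1), (i : ℕ) + 1 < n + 1 ↔ i ≠ Fin.last n := fun i => by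
    rw [← Fin.lt_last_iff_ne_last, Fin.lt_def, Fin.val_last]; omega
  have heq : ∀ i : Fin (n + 1), (i : ℕ) + 1 = n + 1 ↔ i = Fin.last n := fun i => by
    rw [Fin.ext_iff, Fin.val_last]; omega
  simp only [collapsingPyramid, hlt, heq]
  set A : Set (EuclideanSpace ℝ (Fin (n + 1))) := {x |
    (∀ i, i ≠ Fin.last n → x i ∈ Ioo (-1 : ℝ) 1) ∧ (∀ i, i = Fin.last n → x i = 0)}
  set z : EuclideanSpace ℝ (Fin (n + 1)) := WithLp.toLp 2 fun i => if i = Fin.last n then α else 0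
  apply Subset.antisymm
  · have hsub : convexHull ℝ (A ∪ {z}) ⊆
        {x | 0 ≤ x (Fin.last n) ∧ x (Fin.last n) ≤ α ∧
          ∀ i, i ≠ Fin.last n → |x i| ≤ 1 - x (Fin.last n) / α} := by
      refine convexHull_min ?_ ?_
      · rintro x (⟨h1, h2⟩ | rfl)
        · refine ⟨(h2 _ rfl).ge, by rw [h2 _ rfl]; exact hα.le, fun i hi => ?_⟩
          rw [h2 _ rfl, zero_div, sub_zero]
          exact (abs_lt.2 (h1 i hi)).le
        · refine ⟨by simp [z, hα.le], by simp [z], fun i hi => ?_⟩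
          simp [z, hi, hα.ne']
      · rintro x ⟨hx1, hx2, hx3⟩ y ⟨hy1, hy2, hy3⟩ a b ha hb hab
        refine ⟨?_, ?_, fun i hi => ?_⟩
        · simp only [PiLp.add_apply, PiLp.smul_apply, smul_eq_mul]; positivity
        · simp only [PiLp.add_apply, PiLp.smul_apply, smul_eq_mul]
          calc _ ≤ a * α + b * α := by gcongr
            _ = α := by rw [← add_mul, hab, one_mul]
        · simp only [PiLp.add_apply, PiLp.smul_apply, smul_eq_mul]
          calc |a * x i + b * y i| ≤ |a * x i| + |b * y i| := abs_add_le _ _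
            _ = a * |x i| + b * |y i| := by rw [abs_mul, abs_mul, abs_of_nonneg ha, abs_of_nonneg hb]
            _ ≤ a * (1 - x (Fin.last n) / α) + b * (1 - y (Fin.last n) / α) := by
              gcongr
              · exact hx3 i hi
              · exact hy3 i hi
            _ = (a + b) - (a * x (Fin.last n) + b * y (Fin.last n)) / α := by ring
            _ = _ := by rw [hab]
    intro x hx
    obtain ⟨ε, hε, hball⟩ := Metric.isOpen_iff.1 isOpen_interior x hx
    -- Moving an interior point vertically by `±ε / 2` keeps it in the closed pyramid; since the
    -- height enters every constraint, this makes all of them strict.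
    have hmem : ∀ s : ℝ, |s| < ε → x + EuclideanSpace.single (Fin.last n) s ∈
        {x : EuclideanSpace ℝ (Fin (n + 1)) | 0 ≤ x (Fin.last n) ∧ x (Fin.last n) ≤ α ∧
          ∀ i, i ≠ Fin.last n → |x i| ≤ 1 - x (Fin.last n) / α} := fun s hs =>
      hsub (interior_subset (hball (by simpa [mem_ball_iff_norm] using hs)))
    have h1 := hmem (ε / 2) (by rw [abs_of_pos (by positivity)]; linarith)
    have h2 := hmem (-(ε / 2)) (by rw [abs_neg, abs_of_pos (by positivity)]; linarith)
    have h3 := h2.1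
    have h4 := h1.2.1
    simp only [PiLp.add_apply, PiLp.single_apply, if_true] at h3 h4
    refine ⟨by linarith, by linarith, fun i hi => ?_⟩
    have h5 := h1.2.2 i hi
    simp only [PiLp.add_apply, PiLp.single_apply, if_true, hi, if_false, add_zero] at h5
    have : x (Fin.last n) / α < (x (Fin.last n) + ε / 2) / α := by gcongr; linarith
    linarith
  · refine interior_maximal ?_ ?_
    · rintro x ⟨hx1, hx2, hx3⟩
      -- The point is `s z + (1 - s) y`, with `y` its projection from the apex `z` to the base.
      set s := x (Fin.last n) / α
      have hs0 : 0 < s := by positivity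
      have hs1 : 0 < 1 - s := sub_pos.2 ((div_lt_one hα).2 hx2)
      have hy : WithLp.toLp 2 (fun i => if i = Fin.last n then 0 else x i / (1 - s)) ∈ A := by
        refine ⟨fun i hi => ?_, fun i hi => by simp [hi]⟩
        simp only [hi, if_false]
        rw [mem_Ioo, ← abs_lt, abs_div, abs_of_pos hs1, div_lt_one hs1]
        exact hx3 i hi
      have h := (convex_convexHull ℝ (A ∪ {z})) (subset_convexHull ℝ (A ∪ {z}) (Or.inr rfl))
        (subset_convexHull ℝ (A ∪ {z}) (Or.inl hy)) hs0.le hs1.le (by ring)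
      convert h using 1
      ext i
      by_cases hi : i = Fin.last n
      · subst hi
        simp only [PiLp.add_apply, PiLp.smul_apply, smul_eq_mul, if_true, s, z]
        field_simp
        ring
      · simp only [PiLp.add_apply, PiLp.smul_apply, smul_eq_mul, hi, if_false, z]
        field_simp
        ring
    · have hc : ∀ i, Continuous fun x : EuclideanSpace ℝ (Fin (n + 1)) => x i := fun i => by fun_prop
      have heq : {x : EuclideanSpace ℝ (Fin (n + 1)) | 0 < x (Fin.last n) ∧ x (Fin.last n) < α ∧
          ∀ i, i ≠ Fin.last n → |x i| < 1 - x (Fin.last n) / α} =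
          {x | 0 < x (Fin.last n)} ∩ ({x | x (Fin.last n) < α} ∩
            ⋂ i, ⋂ (_ : i ≠ Fin.last n), {x | |x i| < 1 - x (Fin.last n) / α}) := by
        ext x; simp
      rw [heq]
      exact (isOpen_lt continuous_const (hc _)).inter
        ((isOpen_lt (hc _) continuous_const).inter
          (isOpen_iInter_of_finite fun i => isOpen_iInter_of_finite fun _ =>
            isOpen_lt (hc i).abs (by fun_prop)))

lemma isOpen_collapsingPyramid (N : ℕ) (α : ℝ) : IsOpen (collapsingPyramid N α) := isOpen_interior

lemma convex_collapsingPyramid (N : ℕ) (α : ℝ) : Convex ℝ (collapsingPyramid N α) :=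
  (convex_convexHull ℝ _).interior

lemma isBounded_collapsingPyramid (n : ℕ) {α : ℝ} (hα : 0 < α) :
    Bornology.IsBounded (collapsingPyramid (n + 1) α) := by
  rw [collapsingPyramid_eq n hα]
  have hb := (Metric.isBounded_closedBall (x := (0 : Fin (n + 1) → ℝ)) (r := max α 1))
  have hc : IsCompact ((WithLp.toLp 2 : (Fin (n + 1) → ℝ) → EuclideanSpace ℝ (Fin (n + 1))) ''
      Metric.closedBall 0 (max α 1)) :=
    (isCompact_closedBall _ _).image (PiLp.continuous_toLp 2 _)
  refine hc.isBounded.subset ?_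
  rintro x ⟨h1, h2, h3⟩
  refine ⟨x.ofLp, ?_, rfl⟩
  rw [mem_closedBall_zero_iff, pi_norm_le_iff_of_nonneg (by positivity)]
  intro i
  rw [Real.norm_eq_abs]
  by_cases hi : i = Fin.last n
  · rw [hi, abs_of_pos h1]; exact h2.le.trans (le_max_left _ _)
  · have := h3 i hi
    have h4 : 0 < x (Fin.last n) / α := by positivity
    exact (by linarith : |x i| ≤ 1).trans (le_max_right _ _)

lemma nonempty_collapsingPyramid (n : ℕ) {α : ℝ} (hα : 0 < α) :
    (collapsingPyramid (n + 1) α).Nonempty := by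
  rw [collapsingPyramid_eq n hα]
  refine ⟨EuclideanSpace.single (Fin.last n) (α / 2), ?_, ?_, fun i hi => ?_⟩
  · simpa using hα
  · simpa using hα
  · simp only [PiLp.single_apply, hi, if_false, if_true, abs_zero]
    have : α / 2 / α = 1 / 2 := by field_simp
    rw [this]; norm_num

/-- The part above height `t` lies in the image of the pyramid under the homothety about the apex of
ratio `1 - t / α`. -/
lemma volume_collapsingPyramid_inter_le (n : ℕ) {α t : ℝ} (hα : 0 < α) (ht : t < α) :
    volume (collapsingPyramid (n + 1) α ∩ {x | t < x (Fin.last n)}) ≤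
      ENNReal.ofReal ((1 - t / α) ^ (n + 1)) * volume (collapsingPyramid (n + 1) α) := by
  have hk : 0 < 1 - t / α := sub_pos.2 ((div_lt_one hα).2 ht)
  set k := 1 - t / α
  have hkt : α * k = α - t := by simp only [k]; field_simp
  set z : EuclideanSpace ℝ (Fin (n + 1)) := EuclideanSpace.single (Fin.last n) α
  have hsub : collapsingPyramid (n + 1) α ∩ {x | t < x (Fin.last n)} ⊆
      AffineMap.homothety z k '' collapsingPyramid (n + 1) α := by
    rw [collapsingPyramid_eq n hα]
    rintro x ⟨⟨h1, h2, h3⟩, h4 : t < x (Fin.last n)⟩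
    refine ⟨k⁻¹ • (x - z) + z, ?_, ?_⟩
    · have hl : (k⁻¹ • (x - z) + z) (Fin.last n) = α - (α - x (Fin.last n)) / k := by
        simp [z]; field_simp; ring
      have hi : ∀ i, i ≠ Fin.last n → (k⁻¹ • (x - z) + z) i = x i / k := fun i hi => by
        simp [z, hi]; field_simp
      refine ⟨?_, ?_, fun i hne => ?_⟩
      · rw [hl, sub_pos, div_lt_iff₀ hk]; linarith
      · rw [hl]
        have : 0 < (α - x (Fin.last n)) / k := div_pos (by linarith) hk
        linarith
      · rw [hl, hi i hne, abs_div, abs_of_pos hk, div_lt_iff₀ hk]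
        refine (h3 i hne).trans_le (le_of_eq ?_)
        field_simp
        ring
    · simp [AffineMap.homothety_apply, smul_smul, hk.ne']
  refine (measure_mono hsub).trans (le_of_eq ?_)
  rw [Measure.addHaar_image_homothety, finrank_euclideanSpace, Fintype.card_fin,
    abs_of_nonneg (by positivity)]

/-! ### Perimeter of the collapsing pyramids -/

/-- A continuous plateau function, equal to one at distance at most `r` of `m` and to zero at
distance at least `r + η`. -/
noncomputable def plateau (m r η t : ℝ) : ℝ := max 0 (min 1 (1 + (r - |t - m|) / η))

lemma continuous_plateau (m r η : ℝ) : Continuous (plateau m r η) := by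
  unfold plateau; fun_prop

lemma plateau_nonneg (m r η t : ℝ) : 0 ≤ plateau m r η t := le_max_left _ _

lemma plateau_le_one (m r η t : ℝ) : plateau m r η t ≤ 1 := max_le zero_le_one (min_le_left _ _)

lemma plateau_eq_one {m r η t : ℝ} (hη : 0 < η) (ht : |t - m| ≤ r) : plateau m r η t = 1 := by
  have : 0 ≤ (r - |t - m|) / η := div_nonneg (by linarith) hη.le
  rw [plateau, min_eq_left (by linarith), max_eq_right zero_le_one]

lemma plateau_eq_zero {m r η t : ℝ} (hη : 0 < η) (ht : r + η ≤ |t - m|) : plateau m r η t = 0 := by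
  have : (r - |t - m|) / η ≤ -1 := by rw [div_le_iff₀ hη]; linarith
  rw [plateau, max_eq_left ((min_le_right _ _).trans (by linarith))]

/-- The integrand is at most one and vanishes beyond distance `r + η` from `m`. Dividing by `r + η`
makes the primitive an admissible profile for testing the perimeter. -/
lemma abs_integral_plateau_le {m r η : ℝ} (hr : 0 < r) (hη : 0 < η) (t : ℝ) :
    |∫ s in m..t, plateau m r η s| ≤ r + η := by
  have hint : ∀ a b, IntervalIntegrable (plateau m r η) volume a b := fun a b =>
    (continuous_plateau m r η).intervalIntegrable a b
  have hnear : ∀ t, |t - m| ≤ r + η → |∫ s in m..t, plateau m r η s| ≤ r + η := fun t ht => by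
    have := intervalIntegral.norm_integral_le_of_norm_le_const (f := plateau m r η) (a := m) (b := t)
      (C := 1) fun s _ => by
        rw [Real.norm_of_nonneg (plateau_nonneg _ _ _ _)]; exact plateau_le_one _ _ _ _
    rw [one_mul] at this
    exact this.trans ht
  by_cases h : |t - m| ≤ r + η
  · exact hnear t h
  push Not at h
  have hfar : ∀ t', |t' - m| = r + η → (∀ s ∈ uIcc t' t, r + η ≤ |s - m|) →
      |∫ s in m..t, plateau m r η s| ≤ r + η := fun t' h1 h2 => by
    rw [← intervalIntegral.integral_add_adjacent_intervals (hint m t') (hint t' t),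
      intervalIntegral.integral_congr (g := fun _ => 0) fun s hs => plateau_eq_zero hη (h2 s hs)]
    simpa using hnear t' h1.le
  rcases le_total m t with hmt | hmt
  · rw [abs_of_nonneg (by linarith)] at h
    refine hfar (m + (r + η)) (by rw [add_sub_cancel_left, abs_of_pos (by positivity)])
      fun s hs => ?_
    rw [uIcc_of_le (by linarith)] at hs
    exact le_trans (by linarith [hs.1]) (le_abs_self _)
  · rw [abs_of_nonpos (by linarith)] at h
    refine hfar (m - (r + η)) (by rw [sub_sub_cancel_left, abs_neg, abs_of_pos (by positivity)])
      fun s hs => ?_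
    rw [uIcc_of_ge (by linarith)] at hs
    exact le_trans (by linarith [hs.2]) (neg_le_abs _)

/-- Testing the perimeter with a field parallel to a coordinate axis. -/
lemma setIntegral_deriv_le_perimeter {N : ℕ} {Ω : Set (EuclideanSpace ℝ (Fin N))}
    (ho : IsOpen Ω) (hb : Bornology.IsBounded Ω) (l : Fin N) {f : ℝ → ℝ} (hf : ContDiff ℝ 1 f)
    (hf1 : ∀ t, |f t| ≤ 1) :
    ENNReal.ofReal (∫ x in Ω, deriv f (x l)) ≤ perimeter Ω := by
  obtain ⟨R, hR0, hR⟩ := hb.subset_ball_lt 0 0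
  let χ : ContDiffBump (0 : EuclideanSpace ℝ (Fin N)) := ⟨R, R + 1, hR0, by linarith⟩
  set X : EuclideanSpace ℝ (Fin N) → EuclideanSpace ℝ (Fin N) := fun x =>
    (χ x * f (x l)) • EuclideanSpace.single l 1
  have hl : ContDiff ℝ 1 fun x : EuclideanSpace ℝ (Fin N) => x l := by fun_prop
  have hX : ContDiff ℝ 1 X := ((χ.contDiff (n := 1)).mul (hf.comp hl)).smul contDiff_const
  have hXc : HasCompactSupport X := (χ.hasCompactSupport.mul_right).smul_right
  have hX1 : ∀ x, ‖X x‖ ≤ 1 := fun x => by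
    simp only [X]
    rw [norm_smul, PiLp.norm_single, norm_one, mul_one, norm_mul, Real.norm_eq_abs,
      Real.norm_eq_abs, abs_of_nonneg χ.nonneg]
    exact mul_le_one₀ χ.le_one (abs_nonneg _) (hf1 _)
  have hdiv : ∀ x ∈ Ω, divergence X x = deriv f (x l) := by
    intro x hx
    have hev : X =ᶠ[𝓝 x] fun x => f (x l) • EuclideanSpace.single l (1 : ℝ) := by
      filter_upwards [ho.mem_nhds hx] with y hy
      simp only [X]
      rw [χ.one_of_mem_closedBall (Metric.ball_subset_closedBall (hR hy)), one_mul]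
    have hd : HasFDerivAt (fun x : EuclideanSpace ℝ (Fin N) => x l)
        (EuclideanSpace.proj (𝕜 := ℝ) l) x :=
      (EuclideanSpace.proj (𝕜 := ℝ) l : EuclideanSpace ℝ (Fin N) →L[ℝ] ℝ).hasFDerivAt
    have h2 := (((hf.differentiable one_ne_zero) (x l)).hasDerivAt.comp_hasFDerivAt x hd).smul_const
      (EuclideanSpace.single l (1 : ℝ))
    have h3 : fderiv ℝ X x = _ := hev.fderiv_eq.trans h2.fderiv
    simp only [divergence]
    rw [h3, Finset.sum_eq_single l]
    · simp
    · intro i _ hi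
      simp [hi]
    · simp
  rw [← setIntegral_congr_fun ho.measurableSet hdiv]
  exact le_iSup₂_of_le X ⟨hX, hXc, hX1⟩ le_rfl

/-- The isoperimetric ratio of the collapsing pyramid is at least `2 N / α`. -/
lemma le_perimeter_collapsingPyramid (n : ℕ) {α : ℝ} (hα : 0 < α) :
    ENNReal.ofReal (2 * (n + 1) / α) * volume (collapsingPyramid (n + 1) α) ≤
      perimeter (collapsingPyramid (n + 1) α) := by
  set C := collapsingPyramid (n + 1) α
  have hb : Bornology.IsBounded C := isBounded_collapsingPyramid n hα
  have ho : IsOpen C := isOpen_interior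
  have hfin : volume C ≠ ⊤ := hb.measure_lt_top.ne
  have hfm : IsFiniteMeasure (volume.restrict C) := ⟨by simpa using hb.measure_lt_top⟩
  have key : ∀ δ ∈ Ioo 0 α, ENNReal.ofReal
      ((1 - (1 - δ / α) ^ (n + 1)) / δ * (1 / 2 + δ)⁻¹ * volume.real C) ≤ perimeter C := by
    intro δ hδ
    have hδ0 := hδ.1
    -- The profile `f` rises from nearly `-1` at height `0` to nearly `1` at height `δ`, so both the
    -- base and the slanted faces are counted. Its slope on this slab is `1 / h`; the ramp width `δ
    -- ^ 2` is negligible, so `δ / h → 2`, the source of the factor `2`.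
    set h := δ / 2 + δ ^ 2
    have hh : 0 < h := by positivity
    set k := plateau (δ / 2) (δ / 2) (δ ^ 2)
    have hk : Continuous k := continuous_plateau _ _ _
    set f : ℝ → ℝ := fun t => h⁻¹ * ∫ s in (δ / 2)..t, k s
    have hder : ∀ t, HasDerivAt f (h⁻¹ * k t) t := fun t =>
      (intervalIntegral.integral_hasDerivAt_right (hk.intervalIntegrable _ _)
        (hk.stronglyMeasurableAtFilter _ _) hk.continuousAt).const_mul h⁻¹
    have hderiv : deriv f = fun t => h⁻¹ * k t := funext fun t => (hder t).deriv
    have hf : ContDiff ℝ 1 f := by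
      refine contDiff_one_iff_deriv.2 ⟨fun t => (hder t).differentiableAt, ?_⟩
      rw [hderiv]
      fun_prop
    have hf1 : ∀ t, |f t| ≤ 1 := fun t => by
      simp only [f]
      rw [abs_mul, abs_of_pos (inv_pos.2 hh), inv_mul_le_iff₀ hh, mul_one]
      exact abs_integral_plateau_le (by positivity) (by positivity) t
    refine le_trans (ENNReal.ofReal_le_ofReal ?_)
      (setIntegral_deriv_le_perimeter ho hb (Fin.last n) hf hf1)
    rw [hderiv, integral_const_mul]
    have hmeas : MeasurableSet {x : EuclideanSpace ℝ (Fin (n + 1)) | δ < x (Fin.last n)} :=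
      measurableSet_lt measurable_const (by fun_prop)
    have hslab : (1 - (1 - δ / α) ^ (n + 1)) * volume.real C ≤
        volume.real (C \ {x | δ < x (Fin.last n)}) := by
      have h1 := measureReal_inter_add_sdiff₀ (s := C) (μ := volume) hmeas.nullMeasurableSet hfin
      have h2 : volume.real (C ∩ {x | δ < x (Fin.last n)}) ≤
          (1 - δ / α) ^ (n + 1) * volume.real C := by
        have := ENNReal.toReal_mono (ENNReal.mul_ne_top ENNReal.ofReal_ne_top hfin)
          (volume_collapsingPyramid_inter_le n hα hδ.2)
        rw [ENNReal.toReal_mul, ENNReal.toReal_ofReal] at this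
        · exact this
        · exact pow_nonneg (sub_nonneg.2 ((div_le_one hα).2 hδ.2.le)) _
      linarith
    have hint : volume.real (C \ {x | δ < x (Fin.last n)}) ≤ ∫ x in C, k (x (Fin.last n)) := by
      have hI : IntegrableOn (fun x : EuclideanSpace ℝ (Fin (n + 1)) => k (x (Fin.last n))) C :=
        Integrable.of_bound (hk.comp (by fun_prop)).aestronglyMeasurable 1
          (Eventually.of_forall fun x => by
            rw [Real.norm_of_nonneg (plateau_nonneg _ _ _ _)]; exact plateau_le_one _ _ _ _)
      have hone : ∫ x in C \ {x | δ < x (Fin.last n)}, k (x (Fin.last n)) =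
          volume.real (C \ {x | δ < x (Fin.last n)}) := by
        rw [setIntegral_congr_fun (g := fun _ => (1 : ℝ)) (ho.measurableSet.diff hmeas)]
        · simp
        · rintro x ⟨hx, hx'⟩
          simp only [C] at hx
          rw [collapsingPyramid_eq n hα] at hx
          have h1 := hx.1
          have h2 : x (Fin.last n) ≤ δ := not_lt.1 hx'
          exact plateau_eq_one (by positivity) (abs_le.2 ⟨by linarith, by linarith⟩)
      rw [← hone]
      exact setIntegral_mono_set hI (Eventually.of_forall fun x => plateau_nonneg _ _ _ _)
        (sdiff_subset.eventuallyLE)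
    calc _ = h⁻¹ * ((1 - (1 - δ / α) ^ (n + 1)) * volume.real C) := by
          simp only [h]
          have : δ / 2 + δ ^ 2 = δ * (1 / 2 + δ) := by ring
          rw [this, mul_inv]
          ring
      _ ≤ _ := by
        gcongr
        exact hslab.trans hint
  have hlim : Tendsto (fun δ : ℝ => ENNReal.ofReal
      ((1 - (1 - δ / α) ^ (n + 1)) / δ * (1 / 2 + δ)⁻¹ * volume.real C)) (𝓝[>] 0)
      (𝓝 (ENNReal.ofReal (((n + 1 : ℕ) * α⁻¹) * (1 / 2 + 0)⁻¹ * volume.real C))) := by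
    refine (ENNReal.continuous_ofReal.tendsto _).comp (Tendsto.mul_const _ (Tendsto.mul ?_ ?_))
    · have hd : HasDerivAt (fun s : ℝ => 1 - (1 - s / α) ^ (n + 1)) ((n + 1 : ℕ) * α⁻¹) 0 := by
        have := ((((hasDerivAt_id (0 : ℝ)).div_const α).const_sub 1).fun_pow (n + 1)).const_sub 1
        simpa using this
      have := (hasDerivAt_iff_tendsto_slope.1 hd).mono_left
        (nhdsWithin_mono 0 (fun s (hs : 0 < s) => ne_of_gt hs))
      refine this.congr fun s => ?_
      simp [slope_def_field]
    · have : ContinuousAt (fun δ : ℝ => (1 / 2 + δ)⁻¹) 0 :=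
        ContinuousAt.inv₀ (by fun_prop) (by norm_num)
      exact this.tendsto.mono_left nhdsWithin_le_nhds
  have hfinal := le_of_tendsto hlim (by
    filter_upwards [Ioo_mem_nhdsGT hα] with δ hδ using key δ hδ)
  refine le_trans (le_of_eq ?_) hfinal
  rw [← ofReal_measureReal hfin, ← ENNReal.ofReal_mul (by positivity)]
  congr 1
  push_cast
  field_simp
  ring

/-! ### Smooth almost optimal functions in dimension one -/

lemma tendsto_intervalIntegral_of_bounded {F : ℕ → ℝ → ℝ} {f : ℝ → ℝ} {M : ℝ}
    (hF : ∀ n, Continuous (F n)) (hM : ∀ n, ∀ t ∈ Icc (0 : ℝ) 1, |F n t| ≤ M)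
    (hlim : ∀ t ∈ Ioo (0 : ℝ) 1, Tendsto (fun n => F n t) atTop (𝓝 (f t))) {s : ℝ}
    (hs : s ∈ Icc (0 : ℝ) 1) :
    Tendsto (fun n => ∫ t in (0 : ℝ)..s, F n t) atTop (𝓝 (∫ t in (0 : ℝ)..s, f t)) := by
  refine intervalIntegral.tendsto_integral_filter_of_dominated_convergence (fun _ => M)
    (Eventually.of_forall fun n => (hF n).aestronglyMeasurable) (Eventually.of_forall fun n =>
      Eventually.of_forall fun t ht => ?_) intervalIntegrable_const ?_
  · rw [uIoc_of_le hs.1] at ht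
    exact hM n t ⟨ht.1.le, ht.2.trans hs.2⟩
  · filter_upwards [(measure_eq_zero_iff_ae_notMem.1 (measure_singleton (μ := volume) (1 : ℝ)))]
      with t ht1 ht
    rw [uIoc_of_le hs.1] at ht
    exact hlim t ⟨ht.1, lt_of_le_of_ne (ht.2.trans hs.2) ht1⟩

/-- The primitive of a smooth function with zero mean, supported in `[δ, 1 - δ]`. -/
lemma primitive_properties {k : ℝ → ℝ} (hk : ContDiff ℝ ∞ k) {δ : ℝ} (hδ : 0 < δ)
    (hsupp : ∀ t, t ∉ Icc δ (1 - δ) → k t = 0) (hmean : ∫ t in (0 : ℝ)..1, k t = 0) :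
    ContDiff ℝ ∞ (fun t => ∫ s in (0 : ℝ)..t, k s) ∧
      (deriv fun t => ∫ s in (0 : ℝ)..t, k s) = k ∧
      ∀ t, t ∉ Icc δ (1 - δ) → ∫ s in (0 : ℝ)..t, k s = 0 := by
  have hc := hk.continuous
  have hder : ∀ t, HasDerivAt (fun t => ∫ s in (0 : ℝ)..t, k s) (k t) t := fun t =>
    intervalIntegral.integral_hasDerivAt_right (hc.intervalIntegrable _ _)
      (hc.stronglyMeasurableAtFilter _ _) hc.continuousAt
  have hd : (deriv fun t => ∫ s in (0 : ℝ)..t, k s) = k := funext fun t => (hder t).deriv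
  refine ⟨contDiff_infty_iff_deriv.2 ⟨fun t => (hder t).differentiableAt, by rwa [hd]⟩, hd,
    fun t ht => ?_⟩
  by_cases h : t < δ
  · rw [intervalIntegral.integral_congr (g := fun _ => 0) fun s hs => hsupp s fun hs' => ?_]
    · simp
    · have := hs.2.trans_lt (max_lt hδ h)
      exact this.not_ge hs'.1
  · have h1 : 1 - δ < t := by
      by_contra h2
      exact ht ⟨not_lt.1 h, not_lt.1 h2⟩
    rw [← intervalIntegral.integral_add_adjacent_intervals (hc.intervalIntegrable 0 1)
      (hc.intervalIntegrable 1 t), hmean, zero_add,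
      intervalIntegral.integral_congr (g := fun _ => 0) fun s hs => hsupp s fun hs' => ?_]
    · simp
    · have := (lt_min (by linarith : 1 - δ < 1) h1).trans_le hs.1
      exact this.not_ge hs'.2

/-- Smooth zero-mean functions compactly supported in `(0,1)` approximate continuous zero-mean
functions boundedly and pointwise. -/
lemma exists_smooth_approximation {g : ℝ → ℝ} (hg : Continuous g)
    (hmean : ∫ t in (0 : ℝ)..1, g t = 0) :
    ∃ (k : ℕ → ℝ → ℝ) (M : ℝ), (∀ n, ContDiff ℝ ∞ (k n)) ∧
      (∀ n, ∃ δ ∈ Ioo (0 : ℝ) (1 / 2), ∀ t, t ∉ Icc δ (1 - δ) → k n t = 0) ∧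
      (∀ n, ∫ t in (0 : ℝ)..1, k n t = 0) ∧ (∀ n, ∀ t ∈ Icc (0 : ℝ) 1, |k n t| ≤ M) ∧
      ∀ t ∈ Ioo (0 : ℝ) 1, Tendsto (fun n => k n t) atTop (𝓝 (g t)) := by
  obtain ⟨G, hG⟩ := isCompact_Icc.exists_bound_of_continuousOn (s := Icc (0 : ℝ) 1) hg.continuousOn
  have hpol : ∀ n : ℕ, ∃ q : Polynomial ℝ, ∀ t ∈ Icc (0 : ℝ) 1, |q.eval t - g t| < 1 / (n + 1) :=
    fun n => exists_polynomial_near_of_continuousOn 0 1 g hg.continuousOn _ (by positivity)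
  choose q hq using hpol
  -- The shift by `8` gives `δ n ≤ 1 / 8`: the cutoff radii are positive, and the correcting bump,
  -- of radius `1 / 4`, is supported inside `[δ n, 1 - δ n]`.
  have hδ : ∀ n : ℕ, 0 < 1 / ((n : ℝ) + 8) ∧ 1 / ((n : ℝ) + 8) ≤ 1 / 8 := fun n =>
    ⟨by positivity, one_div_le_one_div_of_le (by norm_num) (by linarith [n.cast_nonneg (α := ℝ)])⟩
  set δ : ℕ → ℝ := fun n => 1 / ((n : ℝ) + 8)
  let χ : ∀ n : ℕ, ContDiffBump (1 / 2 : ℝ) := fun n =>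
    ⟨1 / 2 - 2 * δ n, 1 / 2 - δ n, by linarith [(hδ n).2], by linarith [(hδ n).1]⟩
  -- Cutting off destroys the zero mean; subtracting the mean times this normalised bump restores
  -- it, and the correction tends to zero.
  let β : ContDiffBump (1 / 2 : ℝ) := ⟨1 / 8, 1 / 4, by norm_num, by norm_num⟩
  set b : ℝ → ℝ := β.normed volume
  have hbs : ContDiff ℝ ∞ b := β.contDiff_normed
  have hb0 : ∀ t, 1 / 4 ≤ |t - 1 / 2| → b t = 0 := fun t ht => by
    have : t ∉ Function.support b := by
      rw [β.support_normed_eq, Metric.mem_ball, Real.dist_eq]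
      exact not_lt.2 ht
    exact Function.notMem_support.1 this
  have hb1 : ∫ t in (0 : ℝ)..1, b t = 1 := by
    rw [intervalIntegral.integral_of_le zero_le_one]
    refine Eq.trans ?_ (β.integral_normed (μ := volume))
    refine setIntegral_eq_integral_of_forall_compl_eq_zero fun t ht => hb0 t ?_
    rw [mem_Ioc, not_and_or, not_lt, not_le] at ht
    rcases ht with h | h
    · exact le_trans (by linarith) (neg_le_abs _)
    · exact le_trans (by linarith) (le_abs_self _)
  obtain ⟨D, hD⟩ := isCompact_Icc.exists_bound_of_continuousOn (s := Icc (0 : ℝ) 1)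
    hbs.continuous.continuousOn
  set h : ℕ → ℝ → ℝ := fun n t => (q n).eval t * χ n t
  have hh : ∀ n, ContDiff ℝ ∞ (h n) := fun n => (Polynomial.contDiff_aeval (q n) ∞).mul (χ n).contDiff
  have hhM : ∀ n, ∀ t ∈ Icc (0 : ℝ) 1, |h n t| ≤ G + 1 := fun n t ht => by
    have h1 : |(q n).eval t| ≤ G + 1 := by
      have h2 := hq n t ht
      have h3 := hG t ht
      have h4 : 1 / ((n : ℝ) + 1) ≤ 1 := by
        rw [div_le_one (by positivity)]; linarith [n.cast_nonneg (α := ℝ)]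
      rw [Real.norm_eq_abs] at h3
      have h5 := abs_sub_abs_le_abs_sub ((q n).eval t) (g t)
      linarith
    simp only [h]
    rw [abs_mul, abs_of_nonneg (χ n).nonneg]
    exact (mul_le_of_le_one_right (abs_nonneg _) (χ n).le_one).trans h1
  have hhlim : ∀ t ∈ Ioo (0 : ℝ) 1, Tendsto (fun n => h n t) atTop (𝓝 (g t)) := fun t ht => by
    have hqlim : Tendsto (fun n => (q n).eval t) atTop (𝓝 (g t)) := by
      rw [tendsto_iff_dist_tendsto_zero]
      exact squeeze_zero (fun _ => dist_nonneg)
        (fun n => (hq n t (Ioo_subset_Icc_self ht)).le) tendsto_one_div_add_atTop_nhds_zero_nat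
    have hδlim : Tendsto δ atTop (𝓝 0) := by
      have := (tendsto_const_div_atTop_nhds_zero_nat (1 : ℝ)).comp (tendsto_add_atTop_nat 8)
      refine this.congr fun n => ?_
      simp [δ]
    have hpos : 0 < (1 / 2 - |t - 1 / 2|) / 2 := by
      have : |t - 1 / 2| < 1 / 2 := abs_lt.2 ⟨by linarith [ht.1], by linarith [ht.2]⟩
      linarith
    refine hqlim.congr' ?_
    filter_upwards [hδlim.eventually_lt_const hpos] with n hn
    have : χ n t = 1 := (χ n).one_of_mem_closedBall (by
      rw [Metric.mem_closedBall, Real.dist_eq]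
      change |t - 1 / 2| ≤ 1 / 2 - 2 * δ n
      linarith)
    simp only [h]
    rw [this, mul_one]
  set m : ℕ → ℝ := fun n => ∫ t in (0 : ℝ)..1, h n t
  have hmlim : Tendsto m atTop (𝓝 0) := by
    rw [← hmean]
    exact tendsto_intervalIntegral_of_bounded (fun n => (hh n).continuous) hhM hhlim
      (right_mem_Icc.2 zero_le_one)
  have hmM : ∀ n, |m n| ≤ G + 1 := fun n => by
    have := intervalIntegral.norm_integral_le_of_norm_le_const (f := h n) (a := 0) (b := 1)
      (C := G + 1) fun t ht => by
        rw [uIoc_of_le zero_le_one] at ht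
        exact hhM n t (Ioc_subset_Icc_self ht)
    simpa using this
  refine ⟨fun n t => h n t - m n * b t, G + 1 + (G + 1) * D,
    fun n => (hh n).sub (contDiff_const.mul hbs), fun n => ⟨δ n, ⟨(hδ n).1, by linarith [(hδ n).2]⟩,
    fun t ht => ?_⟩, fun n => ?_, fun n t ht => ?_, fun t ht => ?_⟩
  · have h1 : 1 / 2 - δ n ≤ |t - 1 / 2| := by
      rw [mem_Icc, not_and_or, not_le, not_le] at ht
      rcases ht with h | h
      · exact le_trans (by linarith) (neg_le_abs _)
      · exact le_trans (by linarith) (le_abs_self _)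
    have h2 : χ n t = 0 := (χ n).zero_of_le_dist (by rw [Real.dist_eq]; exact h1)
    simp only [h]
    rw [h2, hb0 t (by linarith [(hδ n).2]), mul_zero, mul_zero, sub_zero]
  · have hi : IntervalIntegrable (fun t => m n * b t) volume 0 1 :=
      (continuous_const.mul hbs.continuous).intervalIntegrable _ _
    simp only
    rw [intervalIntegral.integral_sub ((hh n).continuous.intervalIntegrable _ _) hi,
      intervalIntegral.integral_const_mul, hb1, mul_one]
    exact sub_self _
  · refine (abs_sub _ _).trans ?_
    rw [abs_mul (m n)]
    have := hD t ht
    rw [Real.norm_eq_abs] at this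
    have h0 := hmM n
    exact add_le_add (hhM n t ht) (mul_le_mul h0 this (abs_nonneg _) ((abs_nonneg _).trans h0))
  · simpa using (hhlim t ht).sub (hmlim.mul_const (b t))

lemma lintegral_enorm_rpow_eq_of_support {f : ℝ → ℝ} (hf : Continuous f) {p : ℝ} (hp : 0 < p)
    (hs : ∀ t, t ∉ Icc (0 : ℝ) 1 → f t = 0) :
    ∫⁻ t, ‖f t‖ₑ ^ p = ENNReal.ofReal (∫ t in (0 : ℝ)..1, |f t| ^ p) := by
  rw [← lintegral_enorm_rpow_Icc hf hp zero_le_one, ← lintegral_indicator measurableSet_Icc]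
  refine lintegral_congr fun t => ?_
  by_cases ht : t ∈ Icc (0 : ℝ) 1
  · rw [indicator_of_mem ht]
  · rw [indicator_of_notMem ht, hs t ht]
    simp [hp]

/-- Almost optimal functions for the one-dimensional Poincaré inequality can be taken smooth and
compactly supported in `(0,1)`. -/
lemma exists_smooth_almost_optimal {p : ℝ} (hp : 1 < p) {c : ℝ≥0∞} (hc : poincarePi p < c) :
    ∃ (v : ℝ → ℝ) (δ : ℝ), δ ∈ Ioo (0 : ℝ) (1 / 2) ∧ ContDiff ℝ ∞ v ∧
      (∀ t, t ∉ Icc δ (1 - δ) → v t = 0) ∧ v ≠ 0 ∧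
      ∫⁻ t, ‖deriv v t‖ₑ ^ p ≤ c ^ p * ∫⁻ t, ‖v t‖ₑ ^ p := by
  have hp0 : 0 < p := by linarith
  have hpow : Continuous fun x : ℝ => |x| ^ p := continuous_abs.rpow_const fun x => Or.inr hp0.le
  simp only [poincarePi, iInf_lt_iff] at hc
  obtain ⟨φ, ⟨hφ, h0, h1, t0, ht0, hφt⟩, hlt⟩ := hc
  have hud : UniqueDiffOn ℝ (Icc (0 : ℝ) 1) := uniqueDiffOn_Icc zero_lt_one
  have hg0 : ContinuousOn (derivWithin φ (Icc 0 1)) (Icc 0 1) :=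
    hφ.continuousOn_derivWithin hud le_rfl
  -- The one-sided derivative is extended by its endpoint values to a continuous function on the
  -- line, of which `φ` is the primitive on `[0,1]`.
  set g : ℝ → ℝ := IccExtend (zero_le_one (α := ℝ)) ((Icc 0 1).domRestrict (derivWithin φ (Icc 0 1)))
  have hg : Continuous g := (continuousOn_iff_continuous_domRestrict.1 hg0).Icc_extend'
  have hgeq : ∀ t ∈ Icc (0 : ℝ) 1, g t = derivWithin φ (Icc 0 1) t := fun t ht => by
    simp only [g]; rw [IccExtend_of_mem _ _ ht]; rfl
  have hprim : ∀ t ∈ Icc (0 : ℝ) 1, ∫ s in (0 : ℝ)..t, g s = φ t := by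
    intro t ht
    rw [intervalIntegral.integral_eq_sub_of_hasDerivAt_of_le ht.1
      (hφ.continuousOn.mono (Icc_subset_Icc_right ht.2)) (fun s hs => ?_)
      (hg.intervalIntegrable _ _), h0, sub_zero]
    have hs' : s ∈ Ioo (0 : ℝ) 1 := ⟨hs.1, hs.2.trans_le ht.2⟩
    rw [hgeq s (Ioo_subset_Icc_self hs')]
    exact ((hφ.differentiableOn one_ne_zero) s (Ioo_subset_Icc_self hs')).hasDerivWithinAt.hasDerivAt
      (Icc_mem_nhds hs'.1 hs'.2)
  set Φ : ℝ → ℝ := fun t => ∫ s in (0 : ℝ)..t, g s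
  have hΦ : Continuous Φ := intervalIntegral.continuous_primitive
    (fun a b => hg.intervalIntegrable a b) 0
  have hA : eLpNorm (derivWithin φ (Icc 0 1)) (ENNReal.ofReal p) (volume.restrict (Icc 0 1)) =
      ENNReal.ofReal (∫ t in (0 : ℝ)..1, |g t| ^ p) ^ (1 / p) := by
    rw [lintegral_rpow_eq_eLpNorm_rpow hp0, ← lintegral_enorm_rpow_Icc hg hp0 zero_le_one]
    congr 1
    exact setLIntegral_congr_fun measurableSet_Icc fun t ht => by simp only [hgeq t ht]
  have hB : eLpNorm φ (ENNReal.ofReal p) (volume.restrict (Icc 0 1)) =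
      ENNReal.ofReal (∫ t in (0 : ℝ)..1, |Φ t| ^ p) ^ (1 / p) := by
    rw [lintegral_rpow_eq_eLpNorm_rpow hp0, ← lintegral_enorm_rpow_Icc hΦ hp0 zero_le_one]
    congr 1
    exact setLIntegral_congr_fun measurableSet_Icc fun t ht => by simp only [Φ, hprim t ht]
  have hBpos : 0 < ∫ t in (0 : ℝ)..1, |Φ t| ^ p := by
    refine intervalIntegral.integral_pos zero_lt_one (hpow.comp hΦ).continuousOn
      (fun t _ => by positivity) ⟨t0, ht0, ?_⟩
    have : 0 < |Φ t0| := by rw [abs_pos]; simp only [Φ]; rwa [hprim t0 ht0]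
    positivity
  have hB0 : ENNReal.ofReal (∫ t in (0 : ℝ)..1, |Φ t| ^ p) ≠ 0 := by simpa using hBpos
  have hAB : ENNReal.ofReal (∫ t in (0 : ℝ)..1, |g t| ^ p) <
      c ^ p * ENNReal.ofReal (∫ t in (0 : ℝ)..1, |Φ t| ^ p) := by
    rw [hA, hB, ← ENNReal.div_rpow_of_nonneg _ _ (by positivity)] at hlt
    have := ENNReal.rpow_lt_rpow hlt hp0
    rw [← ENNReal.rpow_mul, one_div_mul_cancel hp0.ne', ENNReal.rpow_one,
      ENNReal.div_lt_iff (Or.inl hB0) (Or.inl ENNReal.ofReal_ne_top)] at this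
    exact this
  -- The derivative is approximated rather than `φ`: primitives of zero-mean functions supported
  -- inside `(0,1)` are themselves supported there, and both integrals converge by bounded
  -- convergence.
  obtain ⟨k, M, hk, hks, hkm, hkM, hklim⟩ := exists_smooth_approximation hg
    ((hprim 1 (right_mem_Icc.2 zero_le_one)).trans h1)
  have hM0 : 0 ≤ M := (abs_nonneg _).trans (hkM 0 0 (left_mem_Icc.2 zero_le_one))
  set w : ℕ → ℝ → ℝ := fun n t => ∫ s in (0 : ℝ)..t, k n s
  have hwc : ∀ n, Continuous (w n) := fun n => intervalIntegral.continuous_primitive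
    (fun a b => (hk n).continuous.intervalIntegrable a b) 0
  have hwM : ∀ n, ∀ t ∈ Icc (0 : ℝ) 1, |w n t| ≤ M := fun n t ht => by
    have := intervalIntegral.norm_integral_le_of_norm_le_const (f := k n) (a := 0) (b := t)
      (C := M) fun s hs => by
        rw [uIoc_of_le ht.1] at hs
        exact hkM n s ⟨hs.1.le, hs.2.trans ht.2⟩
    rw [sub_zero, abs_of_nonneg ht.1] at this
    exact this.trans (mul_le_of_le_one_right hM0 ht.2)
  have hwlim : ∀ t ∈ Ioo (0 : ℝ) 1, Tendsto (fun n => w n t) atTop (𝓝 (Φ t)) := fun t ht =>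
    tendsto_intervalIntegral_of_bounded (fun n => (hk n).continuous) hkM hklim
      (Ioo_subset_Icc_self ht)
  have hrp : ∀ {x : ℝ}, |x| ≤ M → |(|x| ^ p)| ≤ M ^ p := fun {x} hx => by
    rw [abs_of_nonneg (by positivity)]
    exact Real.rpow_le_rpow (abs_nonneg _) hx hp0.le
  have hAlim : Tendsto (fun n => ∫ t in (0 : ℝ)..1, |k n t| ^ p) atTop
      (𝓝 (∫ t in (0 : ℝ)..1, |g t| ^ p)) :=
    tendsto_intervalIntegral_of_bounded (fun n => hpow.comp (hk n).continuous)
      (fun n t ht => hrp (hkM n t ht)) (fun t ht => (hpow.tendsto _).comp (hklim t ht))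
      (right_mem_Icc.2 zero_le_one)
  have hBlim : Tendsto (fun n => ∫ t in (0 : ℝ)..1, |w n t| ^ p) atTop
      (𝓝 (∫ t in (0 : ℝ)..1, |Φ t| ^ p)) :=
    tendsto_intervalIntegral_of_bounded (fun n => hpow.comp (hwc n))
      (fun n t ht => hrp (hwM n t ht)) (fun t ht => (hpow.tendsto _).comp (hwlim t ht))
      (right_mem_Icc.2 zero_le_one)
  have hev := ((ENNReal.continuous_ofReal.tendsto _).comp hAlim).eventually_lt
    (ENNReal.Tendsto.const_mul (a := c ^ p) ((ENNReal.continuous_ofReal.tendsto _).comp hBlim)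
      (Or.inl hB0)) hAB
  obtain ⟨n, hn⟩ := hev.exists
  obtain ⟨δ, hδ, hδs⟩ := hks n
  obtain ⟨hw1, hw2, hw3⟩ := primitive_properties (hk n) hδ.1 hδs (hkm n)
  have hsub : ∀ t, t ∉ Icc (0 : ℝ) 1 → t ∉ Icc δ (1 - δ) := fun t ht h =>
    ht ⟨hδ.1.le.trans h.1, h.2.trans (by linarith [hδ.1])⟩
  simp only [Function.comp_apply] at hn
  refine ⟨w n, δ, hδ, hw1, hw3, fun hz => ?_, ?_⟩
  -- The inequality is still strict at this stage, so its right side is nonzero.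
  · rw [hz] at hn
    simp [hp0.ne'] at hn
  · have hdw : deriv (w n) = k n := hw2
    rw [hdw, lintegral_enorm_rpow_eq_of_support (hk n).continuous hp0
      fun t ht => hδs t (hsub t ht), lintegral_enorm_rpow_eq_of_support (hwc n) hp0
      fun t ht => hw3 t (hsub t ht)]
    exact hn.le

/-! ### Product test functions on boxes -/

/-- Fubini for a separable integrand. The factorisation passes through real integrals, and compact
support makes the factors integrable. -/
lemma lintegral_enorm_prod_rpow {N : ℕ} {f : Fin N → ℝ → ℝ} (hf : ∀ i, Continuous (f i))
    (hc : ∀ i, HasCompactSupport (f i)) {p : ℝ} (hp : 0 < p) :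
    ∫⁻ x : EuclideanSpace ℝ (Fin N), ‖∏ i, f i (x i)‖ₑ ^ p = ∏ i, ∫⁻ t, ‖f i t‖ₑ ^ p := by
  have hcont : ∀ i, Continuous fun t => |f i t| ^ p := fun i =>
    (hf i).abs.rpow_const fun t => Or.inr hp.le
  have hint : ∀ i, Integrable fun t => |f i t| ^ p := fun i =>
    (hcont i).integrable_of_hasCompactSupport ((hc i).comp_left (g := fun t => |t| ^ p)
      (by simp [hp.ne']))
  have hpt : ∀ a : ℝ, ‖a‖ₑ ^ p = ENNReal.ofReal (|a| ^ p) := fun a => by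
    rw [← ENNReal.ofReal_rpow_of_nonneg (abs_nonneg _) hp.le, ← Real.norm_eq_abs, ofReal_norm]
  have hmeas : Measurable fun x : EuclideanSpace ℝ (Fin N) => ‖∏ i, f i (x i)‖ₑ ^ p := by
    have : Continuous fun x : EuclideanSpace ℝ (Fin N) => ∏ i, f i (x i) :=
      continuous_finsetProd _ fun i _ => (hf i).comp (by fun_prop)
    exact this.measurable.enorm.pow_const _
  rw [← (PiLp.volume_preserving_toLp (Fin N)).lintegral_comp hmeas]
  have h1 : ∀ x : Fin N → ℝ, ‖∏ i, f i ((WithLp.toLp 2 x : EuclideanSpace ℝ (Fin N)) i)‖ₑ ^ p =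
      ENNReal.ofReal (∏ i, |f i (x i)| ^ p) := fun x => by
    rw [hpt, Finset.abs_prod, ← Real.finsetProd_rpow _ _ fun i _ => abs_nonneg _]
  simp only [h1]
  have hint' : Integrable (fun x : Fin N → ℝ => ∏ i, |f i (x i)| ^ p) volume :=
    Integrable.fintype_prod hint
  rw [← ofReal_integral_eq_lintegral_ofReal hint'
    (Eventually.of_forall fun x => Finset.prod_nonneg fun i _ => by positivity)]
  have h2 := integral_fintype_prod_volume_eq_prod (fun i t => |f i t| ^ p)
  rw [h2, ENNReal.ofReal_prod_of_nonneg fun i _ => integral_nonneg fun t => by positivity]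
  refine Finset.prod_congr rfl fun i _ => ?_
  rw [ofReal_integral_eq_lintegral_ofReal (hint i)
    (Eventually.of_forall fun t => by positivity)]
  exact lintegral_congr fun t => (hpt _).symm

/-- Product rule and triangle inequality. Writing each partial derivative with `Function.update`
keeps it a product, so its `p`-th power integral factorises as well. -/
lemma norm_gradient_prod_le {N : ℕ} {w : Fin N → ℝ → ℝ} (hw : ∀ i, Differentiable ℝ (w i))
    (x : EuclideanSpace ℝ (Fin N)) :
    ‖gradient (fun x : EuclideanSpace ℝ (Fin N) => ∏ i, w i (x i)) x‖ ≤
      ∑ j, |∏ i, (Function.update w j (deriv (w j))) i (x i)| := by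
  have hproj : ∀ i, HasFDerivAt (fun x : EuclideanSpace ℝ (Fin N) => x i)
      (EuclideanSpace.proj (𝕜 := ℝ) i : EuclideanSpace ℝ (Fin N) →L[ℝ] ℝ) x := fun i =>
    (EuclideanSpace.proj (𝕜 := ℝ) i : EuclideanSpace ℝ (Fin N) →L[ℝ] ℝ).hasFDerivAt
  have hd := HasFDerivAt.finsetProd (u := Finset.univ) (x := x)
    (g := fun i (x : EuclideanSpace ℝ (Fin N)) => w i (x i))
    fun i _ => ((hw i) (x i)).hasDerivAt.comp_hasFDerivAt x (hproj i)
  rw [gradient, LinearIsometryEquiv.norm_map, hd.fderiv]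
  refine (norm_sum_le _ _).trans (Finset.sum_le_sum fun j _ => ?_)
  rw [norm_smul, norm_smul]
  have hn : ‖(EuclideanSpace.proj (𝕜 := ℝ) j : EuclideanSpace ℝ (Fin N) →L[ℝ] ℝ)‖ ≤ 1 :=
    ContinuousLinearMap.opNorm_le_bound _ zero_le_one fun y => by
      rw [one_mul]; exact PiLp.norm_apply_le y j
  have he : ∏ i, (Function.update w j (deriv (w j))) i (x i) =
      (∏ i ∈ Finset.univ.erase j, w i (x i)) * deriv (w j) (x j) := by
    rw [← Finset.prod_erase_mul _ _ (Finset.mem_univ j), Function.update_self]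
    congr 1
    exact Finset.prod_congr rfl fun i hi => by
      rw [Function.update_of_ne (Finset.ne_of_mem_erase hi)]
  rw [he, abs_mul, Real.norm_eq_abs, Real.norm_eq_abs]
  gcongr
  exact mul_le_of_le_one_right (abs_nonneg _) hn

/-- Rayleigh quotient of a product function. -/
lemma lintegral_gradient_prod_le {N : ℕ} {p : ℝ} (hp : 1 < p) {w : Fin N → ℝ → ℝ}
    (hw : ∀ i, ContDiff ℝ ∞ (w i)) (hc : ∀ i, HasCompactSupport (w i)) {C : Fin N → ℝ≥0∞}
    (hC : ∀ i, ∫⁻ t, ‖deriv (w i) t‖ₑ ^ p ≤ C i ^ p * ∫⁻ t, ‖w i t‖ₑ ^ p) :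
    ∫⁻ x, ‖gradient (fun x : EuclideanSpace ℝ (Fin N) => ∏ i, w i (x i)) x‖ₑ ^ p ≤
      (∑ i, C i) ^ p * ∫⁻ x : EuclideanSpace ℝ (Fin N), ‖∏ i, w i (x i)‖ₑ ^ p := by
  have hp0 : 0 < p := by linarith
  have hD : ∀ j i, Continuous ((Function.update w j (deriv (w j))) i) := fun j i => by
    by_cases hij : i = j
    · subst hij
      rw [Function.update_self]
      exact (hw i).continuous_deriv (by simp)
    · rw [Function.update_of_ne hij]
      exact (hw i).continuous
  have hDc : ∀ j i, HasCompactSupport ((Function.update w j (deriv (w j))) i) := fun j i => by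
    by_cases hij : i = j
    · subst hij
      rw [Function.update_self]
      exact (hc i).deriv
    · rw [Function.update_of_ne hij]
      exact hc i
  set D : Fin N → EuclideanSpace ℝ (Fin N) → ℝ := fun j x =>
    ∏ i, (Function.update w j (deriv (w j))) i (x i)
  have hDcont : ∀ j, Continuous (D j) := fun j =>
    continuous_finsetProd _ fun i _ => (hD j i).comp (by fun_prop)
  set U : EuclideanSpace ℝ (Fin N) → ℝ := fun x => ∏ i, w i (x i)
  set I := ∫⁻ x, ‖U x‖ₑ ^ p
  have hDle : ∀ j, ∫⁻ x, ‖D j x‖ₑ ^ p ≤ C j ^ p * I := fun j => by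
    simp only [D, I, U]
    rw [lintegral_enorm_prod_rpow (hD j) (hDc j) hp0,
      lintegral_enorm_prod_rpow (fun i => (hw i).continuous) hc hp0,
      ← Finset.prod_erase_mul _ _ (Finset.mem_univ j), Function.update_self,
      ← Finset.prod_erase_mul _ (fun i => ∫⁻ t, ‖w i t‖ₑ ^ p) (Finset.mem_univ j),
      mul_left_comm]
    refine mul_le_mul' (le_of_eq ?_) (hC j)
    exact Finset.prod_congr rfl fun i hi => by
      rw [Function.update_of_ne (Finset.ne_of_mem_erase hi)]
  have hroot : ∀ j, eLpNorm (D j) (ENNReal.ofReal p) volume ≤ C j * I ^ (1 / p) := fun j => by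
    rw [lintegral_rpow_eq_eLpNorm_rpow hp0]
    refine (ENNReal.rpow_le_rpow (hDle j) (by positivity)).trans (le_of_eq ?_)
    rw [ENNReal.mul_rpow_of_nonneg _ _ (by positivity), ← ENNReal.rpow_mul,
      mul_one_div_cancel hp0.ne', ENNReal.rpow_one]
  -- Minkowski's inequality adds the one-dimensional constants; it handles every `p` without
  -- comparing the Euclidean norm with an `ℓ^p` norm.
  have hsum : eLpNorm (∑ j, fun x => |D j x|) (ENNReal.ofReal p) volume ≤
      (∑ j, C j) * I ^ (1 / p) := by
    refine (eLpNorm_sum_le (fun j _ => (hDcont j).abs.aestronglyMeasurable)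
      (by rw [← ENNReal.ofReal_one]; exact ENNReal.ofReal_le_ofReal hp.le)).trans ?_
    rw [Finset.sum_mul]
    refine Finset.sum_le_sum fun j _ => (le_of_eq ?_).trans (hroot j)
    exact eLpNorm_congr_norm_ae (Eventually.of_forall fun x => by simp)
  have hfin := ENNReal.rpow_le_rpow hsum hp0.le
  rw [lintegral_rpow_eq_eLpNorm_rpow hp0, ENNReal.mul_rpow_of_nonneg _ _ hp0.le,
    ← ENNReal.rpow_mul, ← ENNReal.rpow_mul, one_div_mul_cancel hp0.ne', ENNReal.rpow_one,
    ENNReal.rpow_one] at hfin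
  refine le_trans (lintegral_mono fun x => ENNReal.rpow_le_rpow ?_ hp0.le) hfin
  rw [← ofReal_norm, ← ofReal_norm]
  refine ENNReal.ofReal_le_ofReal ((norm_gradient_prod_le
    (fun i => (hw i).differentiable (by simp)) x).trans (le_of_eq ?_))
  rw [Finset.sum_apply, Real.norm_of_nonneg (Finset.sum_nonneg fun j _ => abs_nonneg _)]

lemma lintegral_comp_div (f : ℝ → ℝ≥0∞) {s : ℝ} (hs : 0 < s) :
    ∫⁻ t, f (t / s) = ENNReal.ofReal s * ∫⁻ t, f t := by
  have h := Real.map_volume_mul_left (a := s⁻¹) (by positivity)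
  rw [inv_inv, abs_of_pos hs] at h
  have he : MeasurableEmbedding fun t : ℝ => s⁻¹ * t :=
    (Homeomorph.mulLeft₀ s⁻¹ (by positivity)).measurableEmbedding
  rw [← smul_eq_mul, ← lintegral_smul_measure, ← h, he.lintegral_map]
  exact lintegral_congr fun t => by rw [div_eq_inv_mul]

/-- The effect of a dilation on the one-dimensional Rayleigh quotient. -/
lemma lintegral_deriv_comp_div_le {p : ℝ} (hp : 0 < p) {v : ℝ → ℝ} {c : ℝ≥0∞}
    (h : ∫⁻ t, ‖deriv v t‖ₑ ^ p ≤ c ^ p * ∫⁻ t, ‖v t‖ₑ ^ p) {s : ℝ} (hs : 0 < s) :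
    ∫⁻ t, ‖deriv (fun t => v (t / s)) t‖ₑ ^ p ≤
      (c / ENNReal.ofReal s) ^ p * ∫⁻ t, ‖v (t / s)‖ₑ ^ p := by
  have hd : ∀ t, ‖deriv (fun t => v (t / s)) t‖ₑ ^ p =
      ENNReal.ofReal s⁻¹ ^ p * ‖deriv v (t / s)‖ₑ ^ p := fun t => by
    have h1 : deriv (fun t => v (t / s)) t = s⁻¹ * deriv v (t / s) := by
      simp only [div_eq_inv_mul]
      rw [deriv_comp_mul_left, smul_eq_mul]
    rw [h1, enorm_mul, ENNReal.mul_rpow_of_nonneg _ _ hp.le, Real.enorm_of_nonneg (by positivity)]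
  simp only [hd]
  rw [lintegral_const_mul' _ _ (ENNReal.rpow_ne_top_of_nonneg hp.le ENNReal.ofReal_ne_top),
    lintegral_comp_div (fun t => ‖deriv v t‖ₑ ^ p) hs, lintegral_comp_div (fun t => ‖v t‖ₑ ^ p) hs,
    div_eq_mul_inv, ENNReal.mul_rpow_of_nonneg _ _ hp.le, ENNReal.ofReal_inv_of_pos hs]
  calc _ ≤ (ENNReal.ofReal s)⁻¹ ^ p * (ENNReal.ofReal s * (c ^ p * ∫⁻ t, ‖v t‖ₑ ^ p)) := by gcongr
    _ = _ := by ring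

/-- Upper bound for the first eigenvalue of a set containing a box. -/
lemma firstEigenvalue_le_of_box {N : ℕ} {p : ℝ} (hp : 1 < p) {v : ℝ → ℝ} {δ : ℝ}
    (hv : ContDiff ℝ ∞ v) (hvs : ∀ t, t ∉ Icc δ (1 - δ) → v t = 0)
    (hv0 : v ≠ 0) {c : ℝ≥0∞} (h : ∫⁻ t, ‖deriv v t‖ₑ ^ p ≤ c ^ p * ∫⁻ t, ‖v t‖ₑ ^ p)
    {s : Fin N → ℝ} (hs : ∀ i, 0 < s i) {Ω : Set (EuclideanSpace ℝ (Fin N))} (ho : IsOpen Ω)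
    (hbox : ∀ x : EuclideanSpace ℝ (Fin N), (∀ i, x i / s i ∈ Icc δ (1 - δ)) → x ∈ Ω) :
    firstEigenvalue p Ω ≤ (∑ i, c / ENNReal.ofReal (s i)) ^ p := by
  have hp0 : 0 < p := by linarith
  set w : Fin N → ℝ → ℝ := fun i t => v (t / s i)
  have hw : ∀ i, ContDiff ℝ ∞ (w i) := fun i => hv.comp (contDiff_id.div_const _)
  have hmem : ∀ i t, t / s i ∈ Icc δ (1 - δ) ↔ t ∈ Icc (δ * s i) ((1 - δ) * s i) := fun i t => by
    rw [mem_Icc, mem_Icc, le_div_iff₀ (hs i), div_le_iff₀ (hs i)]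
  have hc : ∀ i, HasCompactSupport (w i) := fun i =>
    HasCompactSupport.intro (isCompact_Icc (a := δ * s i) (b := (1 - δ) * s i)) fun t ht =>
      hvs _ fun h => ht ((hmem i t).1 h)
  set U : EuclideanSpace ℝ (Fin N) → ℝ := fun x => ∏ i, w i (x i)
  have hUsm : ContDiff ℝ ∞ U := contDiff_prod fun i _ => (hw i).comp (by fun_prop)
  set K : Set (EuclideanSpace ℝ (Fin N)) :=
    WithLp.toLp 2 '' (univ.pi fun i => Icc (δ * s i) ((1 - δ) * s i))
  have hK : IsCompact K :=
    (isCompact_univ_pi fun i => isCompact_Icc).image (PiLp.continuous_toLp 2 _)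
  have hmemK : ∀ x : EuclideanSpace ℝ (Fin N), (∀ i, x i / s i ∈ Icc δ (1 - δ)) → x ∈ K :=
    fun x hx => ⟨x.ofLp, fun i _ => (hmem i _).1 (hx i), rfl⟩
  have hKΩ : K ⊆ Ω := by
    rintro _ ⟨x, hx, rfl⟩
    exact hbox _ fun i => (hmem i _).2 (hx i (mem_univ i))
  have hU0 : ∀ x, x ∉ K → U x = 0 := fun x hx => by
    by_contra hne
    refine hx (hmemK x fun i => ?_)
    by_contra hi
    exact hne (Finset.prod_eq_zero (Finset.mem_univ i) (hvs _ hi))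
  have hUc : HasCompactSupport U := HasCompactSupport.intro hK hU0
  have hUs : tsupport U ⊆ Ω := by
    refine (closure_minimal (fun x hx => ?_) hK.isClosed).trans hKΩ
    by_contra hxK
    exact hx (hU0 x hxK)
  obtain ⟨t0, ht0⟩ := Function.ne_iff.1 hv0
  have hUne : U ≠ 0 := by
    refine Function.ne_iff.2 ⟨WithLp.toLp 2 fun i => t0 * s i, ?_⟩
    simp only [U, w, Pi.zero_apply]
    refine Finset.prod_ne_zero_iff.2 fun i _ => ?_
    rw [mul_div_cancel_right₀ _ (hs i).ne']
    exact ht0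
  have hden : ∫⁻ x in Ω, ‖U x‖ₑ ^ p = ∫⁻ x, ‖U x‖ₑ ^ p := by
    rw [← lintegral_indicator ho.measurableSet]
    refine lintegral_congr fun x => ?_
    by_cases hx : x ∈ Ω
    · rw [indicator_of_mem hx]
    · rw [indicator_of_notMem hx, hU0 x fun h => hx (hKΩ h)]
      simp [hp0]
  refine iInf₂_le_of_le U ⟨hUsm, hUc, hUs, hUne⟩ (ENNReal.div_le_of_le_mul ?_)
  rw [hden]
  exact (setLIntegral_le_lintegral _ _).trans
    (lintegral_gradient_prod_le hp hw hc fun i => lintegral_deriv_comp_div_le hp0 h (hs i))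

/-! ### Asymptotic equality and sharpness -/

lemma volume_collapsingPyramid_ne_zero (n : ℕ) {α : ℝ} (hα : 0 < α) :
    volume (collapsingPyramid (n + 1) α) ≠ 0 :=
  ((isOpen_collapsingPyramid _ _).measure_pos volume (nonempty_collapsingPyramid n hα)).ne'

lemma volume_collapsingPyramid_ne_top (n : ℕ) {α : ℝ} (hα : 0 < α) :
    volume (collapsingPyramid (n + 1) α) ≠ ⊤ :=
  (isBounded_collapsingPyramid n hα).measure_lt_top.ne

lemma le_perimeter_div_volume_collapsingPyramid (n : ℕ) {α : ℝ} (hα : 0 < α) :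
    ENNReal.ofReal (2 * (n + 1) / α) ≤
      perimeter (collapsingPyramid (n + 1) α) / volume (collapsingPyramid (n + 1) α) := by
  rw [ENNReal.le_div_iff_mul_le (Or.inl (volume_collapsingPyramid_ne_zero n hα))
    (Or.inl (volume_collapsingPyramid_ne_top n hα))]
  exact le_perimeter_collapsingPyramid n hα

/-- A lower bound for the first eigenvalue of the collapsing pyramid in quotient form. -/
lemma le_firstEigenvalue_collapsingPyramid_div (n : ℕ) {p : ℝ} (hp : 0 < p) {α : ℝ} (hα : 0 < α)
    {C : ℝ≥0∞} (hC : C * (perimeter (collapsingPyramid (n + 1) α) /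
      volume (collapsingPyramid (n + 1) α)) ^ p ≤ firstEigenvalue p (collapsingPyramid (n + 1) α)) :
    C ≤ firstEigenvalue p (collapsingPyramid (n + 1) α) /
      (perimeter (collapsingPyramid (n + 1) α) / volume (collapsingPyramid (n + 1) α)) ^ p := by
  have h0 : perimeter (collapsingPyramid (n + 1) α) / volume (collapsingPyramid (n + 1) α) ≠ 0 := by
    refine ne_of_gt (lt_of_lt_of_le ?_ (le_perimeter_div_volume_collapsingPyramid n hα))
    rw [ENNReal.ofReal_pos]
    positivity
  have ht : perimeter (collapsingPyramid (n + 1) α) / volume (collapsingPyramid (n + 1) α) ≠ ⊤ :=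
    ENNReal.div_ne_top (perimeter_ne_top (isOpen_collapsingPyramid _ _)
      (convex_collapsingPyramid _ _) (isBounded_collapsingPyramid n hα)
      (nonempty_collapsingPyramid n hα)) (volume_collapsingPyramid_ne_zero n hα)
  rwa [ENNReal.le_div_iff_mul_le
    (Or.inl (by simp [ENNReal.rpow_eq_zero_iff, h0, hp.not_gt]))
    (Or.inl (ENNReal.rpow_ne_top_of_nonneg hp.le ht))]

/-- Upper bound for the first eigenvalue of the collapsing pyramid. -/
lemma firstEigenvalue_collapsingPyramid_le (n : ℕ) {p : ℝ} (hp : 1 < p) {c : ℝ≥0∞}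
    (hc : poincarePi p < c) (hct : c ≠ ⊤) :
    ∃ K : ℝ≥0∞, K ≠ ⊤ ∧ ∀ α : ℝ, 0 < α →
      firstEigenvalue p (collapsingPyramid (n + 1) α) ≤ (K + c / ENNReal.ofReal α) ^ p := by
  obtain ⟨v, δ, hδ, hv, hvs, hv0, hle⟩ := exists_smooth_almost_optimal hp hc
  have hδ0 : 0 < δ := hδ.1
  refine ⟨∑ _i : Fin n, c / ENNReal.ofReal δ, ?_, fun α hα => ?_⟩
  · exact ENNReal.sum_ne_top.2 fun _ _ => ENNReal.div_ne_top hct (by simpa using hδ0)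
  -- Scale `α` vertically and `δ` horizontally. At heights up to `(1 - δ) α` the pyramid has
  -- half-width at least `δ`, while the box only reaches `(1 - δ) δ`; the horizontal cost is thus
  -- independent of `α`.
  set s : Fin (n + 1) → ℝ := fun i => if i = Fin.last n then α else δ
  have hs : ∀ i, 0 < s i := fun i => by simp only [s]; split_ifs <;> assumption
  have h := firstEigenvalue_le_of_box hp hv hvs hv0 hle hs
    (isOpen_collapsingPyramid (n + 1) α) fun x hx => ?_
  · refine h.trans (le_of_eq ?_)
    rw [Fin.sum_univ_castSucc]
    simp [s, Fin.castSucc_ne_last]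
  · rw [collapsingPyramid_eq n hα]
    have hl := hx (Fin.last n)
    simp only [s, if_true] at hl
    refine ⟨?_, ?_, fun i hi => ?_⟩
    · have := hδ0.trans_le hl.1
      exact (div_pos_iff_of_pos_right hα).1 this
    · exact (div_lt_one hα).1 (by linarith [hl.2])
    · have h1 := hx i
      simp only [s, hi, if_false] at h1
      have h2 : 0 < x i := (div_pos_iff_of_pos_right hδ0).1 (hδ0.trans_le h1.1)
      have h3 : x i ≤ (1 - δ) * δ := (div_le_iff₀ hδ0).1 h1.2
      rw [abs_of_pos h2]
      nlinarith [hl.2]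

/-- Asymptotic equality for the collapsing pyramids. -/
lemma tendsto_firstEigenvalue_collapsingPyramid (n : ℕ) {p : ℝ} (hp : 1 < p) :
    Tendsto (fun α : ℝ => firstEigenvalue p (collapsingPyramid (n + 1) α) /
        (perimeter (collapsingPyramid (n + 1) α) / volume (collapsingPyramid (n + 1) α)) ^ p)
      (𝓝[>] (0 : ℝ)) (𝓝 ((poincarePi p / (2 * ((n + 1 : ℕ) : ℝ≥0∞))) ^ p)) := by
  have hp0 : 0 < p := by linarith
  set N2 : ℝ≥0∞ := 2 * ((n + 1 : ℕ) : ℝ≥0∞)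
  have hN0 : N2 ≠ 0 := mul_ne_zero two_ne_zero (by exact_mod_cast n.succ_ne_zero)
  have hNt : N2 ≠ ⊤ := ENNReal.mul_ne_top (by simp) (ENNReal.natCast_ne_top _)
  have hNr : ∀ α : ℝ, 0 < α → ENNReal.ofReal (2 * (n + 1) / α) = N2 / ENNReal.ofReal α :=
    fun α hα => by
      rw [ENNReal.ofReal_div_of_pos hα, ENNReal.ofReal_mul zero_le_two]
      congr 2
      · simp
      · rw [← ENNReal.ofReal_natCast]; push_cast; rfl
  refine tendsto_order.2 ⟨fun a ha => ?_, fun b hb => ?_⟩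
  · filter_upwards [self_mem_nhdsWithin] with α hα
    exact ha.trans_le (le_firstEigenvalue_collapsingPyramid_div n hp0 hα
      (le_firstEigenvalue (by omega) hp (isOpen_collapsingPyramid _ _)
        (convex_collapsingPyramid _ _) (isBounded_collapsingPyramid n hα)
        (nonempty_collapsingPyramid n hα)))
  -- If `π_p` were infinite, so would be the proposed limit, and no `b` could lie above it.
  · have hπ : poincarePi p < ⊤ := by
      refine lt_top_iff_ne_top.2 fun h => ?_
      rw [h, ENNReal.top_div_of_ne_top hNt, ENNReal.top_rpow_of_pos hp0] at hb
      exact not_top_lt hb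
    have hcont : Continuous fun c : ℝ≥0∞ => (c / N2) ^ p :=
      ENNReal.continuous_rpow_const.comp (ENNReal.continuous_div_const N2 hN0)
    obtain ⟨c, hc, hcb, hct⟩ : ∃ c, poincarePi p < c ∧ (c / N2) ^ p < b ∧ c < ⊤ := by
      have : (𝓝[>] poincarePi p).NeBot := nhdsGT_neBot_of_exists_gt ⟨_, hπ⟩
      have h1 : ∀ᶠ c in 𝓝[>] poincarePi p, (c / N2) ^ p < b :=
        ((hcont.tendsto _).mono_left nhdsWithin_le_nhds).eventually_lt_const hb
      obtain ⟨c, h2, h3, h4⟩ := (h1.and (Ioo_mem_nhdsGT hπ)).exists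
      exact ⟨c, h3, h2, h4⟩
    obtain ⟨K, hK, hle⟩ := firstEigenvalue_collapsingPyramid_le n hp hc hct.ne
    have hlim : Tendsto (fun α : ℝ => ((K * ENNReal.ofReal α + c) / N2) ^ p) (𝓝[>] 0)
        (𝓝 ((c / N2) ^ p)) := by
      have h1 : Continuous fun α : ℝ => K * ENNReal.ofReal α + c :=
        ((ENNReal.continuous_const_mul hK).comp ENNReal.continuous_ofReal).add continuous_const
      have h2 := ((hcont.comp h1).tendsto 0).mono_left (nhdsWithin_le_nhds (s := Ioi (0 : ℝ)))
      simpa [Function.comp_def] using h2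
    filter_upwards [hlim.eventually_lt_const hcb, self_mem_nhdsWithin] with α hα hα0
    refine lt_of_le_of_lt ?_ hα
    have hα0' : ENNReal.ofReal α ≠ 0 := by simpa using hα0
    -- Multiplying numerator and denominator by `α` makes the horizontal cost the vanishing term `K
    -- α`.
    calc _ ≤ (K + c / ENNReal.ofReal α) ^ p / (N2 / ENNReal.ofReal α) ^ p := by
          refine ENNReal.div_le_div (hle α hα0) (ENNReal.rpow_le_rpow ?_ hp0.le)
          rw [← hNr α hα0]
          exact le_perimeter_div_volume_collapsingPyramid n hα0
      _ = ((K * ENNReal.ofReal α + c) / N2) ^ p := by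
          rw [← ENNReal.div_rpow_of_nonneg _ _ hp0.le]
          congr 1
          rw [div_eq_mul_inv, ENNReal.inv_div (Or.inl ENNReal.ofReal_ne_top) (Or.inl hα0'),
            div_eq_mul_inv (ENNReal.ofReal α), ← mul_assoc, add_mul,
            ENNReal.div_mul_cancel hα0' ENNReal.ofReal_ne_top, ← div_eq_mul_inv]

theorem mainTheorem2 (N : ℕ) (hN : 1 ≤ N) (p : ℝ) (hp : 1 < p) :
    -- the lower bound
    (∀ Ω : Set (EuclideanSpace ℝ (Fin N)),
      IsOpen Ω → Convex ℝ Ω → Bornology.IsBounded Ω → Ω.Nonempty →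
        (poincarePi p / (2 * (N : ℝ≥0∞))) ^ p * (perimeter Ω / volume Ω) ^ p
          ≤ firstEigenvalue p Ω) ∧
    -- the constant is the best possible one
    (∀ C : ℝ≥0∞,
      (∀ Ω : Set (EuclideanSpace ℝ (Fin N)),
        IsOpen Ω → Convex ℝ Ω → Bornology.IsBounded Ω → Ω.Nonempty →
          C * (perimeter Ω / volume Ω) ^ p ≤ firstEigenvalue p Ω) →
      C ≤ (poincarePi p / (2 * (N : ℝ≥0∞))) ^ p) ∧
    -- the collapsing pyramids are admissible, and attain equality asymptotically
    (∀ α : ℝ, 0 < α →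
      IsOpen (collapsingPyramid N α) ∧ Convex ℝ (collapsingPyramid N α) ∧
        Bornology.IsBounded (collapsingPyramid N α) ∧ (collapsingPyramid N α).Nonempty) ∧
    Tendsto
      (fun α : ℝ => firstEigenvalue p (collapsingPyramid N α) /
        (perimeter (collapsingPyramid N α) / volume (collapsingPyramid N α)) ^ p)
      (𝓝[>] (0 : ℝ)) (𝓝 ((poincarePi p / (2 * (N : ℝ≥0∞))) ^ p)) := by
  obtain ⟨n, rfl⟩ : ∃ n, N = n + 1 := ⟨N - 1, by omega⟩
  refine ⟨fun Ω ho hc hb hne => le_firstEigenvalue hN hp ho hc hb hne, fun C hC => ?_,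
    fun α hα => ⟨isOpen_collapsingPyramid _ _, convex_collapsingPyramid _ _,
      isBounded_collapsingPyramid n hα, nonempty_collapsingPyramid n hα⟩,
    tendsto_firstEigenvalue_collapsingPyramid n hp⟩
  -- Any admissible constant bounds the quotient from below on every pyramid, hence also its limit.
  refine ge_of_tendsto (tendsto_firstEigenvalue_collapsingPyramid n hp) ?_
  filter_upwards [self_mem_nhdsWithin] with α hα
  exact le_firstEigenvalue_collapsingPyramid_div n (by linarith) hα
    (hC _ (isOpen_collapsingPyramid _ _) (convex_collapsingPyramid _ _)
      (isBounded_collapsingPyramid n hα) (nonempty_collapsingPyramid n hα))
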